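/- Let $g\ge 0$, let $V=\mathbb C^g$ be a complex vector space with linear coordinates $z_1,\dots,z_g$, let $\Lambda\subset V$ be a lattice (discrete and spanning $V$ over $\mathbb R$), and let $X=V/\Lambda$. Let $B:V\times V\to\mathbb R$ be an alternating $\mathbb R$-bilinear form, put $\sigma(v,w)=e^{2\pi i B(v,w)}$, and let $B_j(v)=B(v,\partial/\partial z_j)$, $\partial/\partial z_j=\tfrac12(\partial/\partial x_j-i\,\partial/\partial y_j)$, with $B$ extended complex bilinearly, so that $B(v,w)=\sum_j\big(B_j(v)w_j+\overline{B_j(v)w_j}\big)$. Let $W$ be the space of smooth functions $\phi:V\times V\to\mathbb C$ such that $$\phi(z+\lambda,w+\lambda)\,\sigma(\lambda,z-w)=\phi(z,w)\qquad(\lambda\in\Lambda)$$ and which satisfy the Schwartz estimates in $z-w$: for every compact $K\subset V$ and all multi-indices $\alpha,\beta,\gamma$, the function $(z-w)^\alpha\,\partial_z^\beta\partial_w^\gamma\phi(z,w)$ (real multi-indices) is bounded on $V\times K$. Let $\mathcal Y^n=W\otimes_{\mathbb C}\Lambda^n(V^{0,1}\oplus V_{1,0})$, where $V^{0,1}\oplus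 V_{1,0}$ has the basis $d\bar z_1,\dots,d\bar z_g,d\bar\zeta_1,\dots,d\bar\zeta_g$; this is the realisation, by invariant functions, of the bimodule $\mathcal Y^\bullet=\mathcal P^\bullet\otimes_{\mathcal A(\Lambda;\sigma)}\mathcal Q^\bullet$. The algebra $\mathcal A(X)=C^\infty(X)$ of complex-valued smooth $\Lambda$-periodic functions on $V$ acts on $\mathcal Y^n$ through the second variable, $(f\phi)(z,w)=f(w)\phi(z,w)$. Define $\mathcal A(X)$-linear operators $\mathcal Y^n\to\mathcal Y^{n+1}$ by $$\mathbb Y^0\phi=\sum_j d\bar z_j\wedge\Big(\frac{\partial\phi}{\partial\bar z_j}+2\pi i\,\overline{B_j(z)}\,\phi\Big)+2\pi i\sum_j (w_j-z_j)\,d\bar\zeta_j\wedge\phi,\qquad \Phi\phi=2\pi i\sum_j\overline{B_j(w-z)}\,d\bar z_j\wedge\phi .$$ Then $(\mathbb Y^0+\Phi)^2=0$, and the cohomology of $(\mathcal Y^\bullet,\mathbb Y^0+\Phi)$ vanishes in every degree except $g$. In degree $g$ it is a free $\mathcal A(X)$-module of rank one, generated by the class of $$a(z,w)\,(d\bar z_1+i\,d\bar\zeta_1)\wedge\cdots\wedge(d\bar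 z_g+i\,d\bar\zeta_g),\qquad a(z,w)=\sigma(z,w)\,e^{-2\pi|z-w|^2},\quad |z-w|^2=\sum_j|z_j-w_j|^2,$$ where $a$ belongs to $W$ and the displayed form is a cocycle. -/

import Mathlib

open scoped ContDiff TensorProduct

noncomputable section

namespace MukaiTorus

/-- The complex vector space `V` of dimension `g`, in linear coordinates `z₁, …, z_g`. -/
abbrev V (g : ℕ) : Type := Fin g → ℂ

variable {g : ℕ}

/-- `σ(v, w) = exp (2πi B(v, w))`, for a real bilinear form `B` on `V`. -/
def sigma (B : LinearMap.BilinForm ℝ (V g)) (v w : V g) : ℂ :=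
  Complex.exp (2 * Real.pi * Complex.I * (B v w : ℂ))

/-- `B_j(v) = B(v, ∂/∂z_j)`, where `∂/∂z_j = (∂/∂x_j - i ∂/∂y_j) / 2` and `B` is extended
complex bilinearly; so `B(v, w) = ∑ j, (B_j(v) w_j + conj (B_j(v) w_j))` for real `B`. -/
def coeffB (B : LinearMap.BilinForm ℝ (V g)) (j : Fin g) (v : V g) : ℂ :=
  ((B v (Pi.single j 1) : ℂ) - Complex.I * (B v (Pi.single j Complex.I) : ℂ)) / 2

/-- The operator `∂/∂z̄_j` in the first variable, on functions of `(z, w)`. -/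
def dbar (j : Fin g) (φ : V g × V g → ℂ) (p : V g × V g) : ℂ :=
  (fderiv ℝ φ p (Pi.single j 1, 0) + Complex.I * fderiv ℝ φ p (Pi.single j Complex.I, 0)) / 2

/-- Smooth functions of `(z, w)` satisfying the Schwartz estimates in `z - w`, uniformly for `w`
in compact sets. -/
structure IsSchwartzInDifference (φ : V g × V g → ℂ) : Prop where
  smooth : ContDiff ℝ ∞ φ
  decay : ∀ K : Set (V g), IsCompact K → ∀ k m : ℕ, ∃ C : ℝ, ∀ z, ∀ w ∈ K,
    ‖z - w‖ ^ k * ‖iteratedFDeriv ℝ m φ (z, w)‖ ≤ C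

/-- Invariance under the action `(φ · l)(z, w) = φ(z + l, w + l) σ(l, z - w)` of the lattice. -/
def IsInvariant (Λ : Submodule ℤ (V g)) (B : LinearMap.BilinForm ℝ (V g))
    (φ : V g × V g → ℂ) : Prop :=
  ∀ l ∈ Λ, ∀ z w : V g, φ (z + l, w + l) * sigma B l (z - w) = φ (z, w)

/-- The algebra `𝒜(X) = C^∞(X)`, `X = V / Λ`, of smooth `Λ`-periodic functions on `V`. -/
def smoothFunctions (Λ : Submodule ℤ (V g)) : Subalgebra ℂ (V g → ℂ) where
  carrier := {f | ContDiff ℝ ∞ f ∧ ∀ l ∈ Λ, ∀ v, f (v + l) = f v}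
  mul_mem' := fun {a b} ha hb =>
    ⟨ha.1.mul hb.1, fun l hl v => by simp [ha.2 l hl v, hb.2 l hl v]⟩
  add_mem' := fun {a b} ha hb =>
    ⟨ha.1.add hb.1, fun l hl v => by simp [ha.2 l hl v, hb.2 l hl v]⟩
  algebraMap_mem' := fun _ => ⟨contDiff_const, fun _ _ _ => rfl⟩

/-! Closure properties of the space of functions that are Schwartz in `z - w`. -/

/-- Smooth functions whose derivatives grow at most polynomially in `z - w`, uniformly for `w` in
compact sets. -/
structure IsTempered (ψ : V g × V g → ℂ) : Prop where
  smooth : ContDiff ℝ ∞ ψ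
  growth : ∀ K : Set (V g), IsCompact K → ∀ m : ℕ, ∃ (C : ℝ) (k : ℕ), ∀ z, ∀ w ∈ K,
    ‖iteratedFDeriv ℝ m ψ (z, w)‖ ≤ C * (1 + ‖z - w‖) ^ k

lemma IsSchwartzInDifference.decay_one_add {φ : V g × V g → ℂ} (h : IsSchwartzInDifference φ)
    {K : Set (V g)} (hK : IsCompact K) (k m : ℕ) : ∃ C : ℝ, ∀ z, ∀ w ∈ K,
    (1 + ‖z - w‖) ^ k * ‖iteratedFDeriv ℝ m φ (z, w)‖ ≤ C := by
  obtain ⟨C₀, h₀⟩ := h.decay K hK 0 m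
  obtain ⟨C₁, h₁⟩ := h.decay K hK k m
  refine ⟨2 ^ (k - 1) * (C₀ + C₁), fun z w hw => ?_⟩
  have e := add_pow_le zero_le_one (norm_nonneg (z - w)) k
  rw [one_pow] at e
  have e₀ := h₀ z w hw
  have e₁ := h₁ z w hw
  rw [pow_zero] at e₀
  calc (1 + ‖z - w‖) ^ k * ‖iteratedFDeriv ℝ m φ (z, w)‖
      ≤ (2 ^ (k - 1) * (1 + ‖z - w‖ ^ k)) * ‖iteratedFDeriv ℝ m φ (z, w)‖ := by gcongr
    _ = 2 ^ (k - 1) * (1 * ‖iteratedFDeriv ℝ m φ (z, w)‖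
          + ‖z - w‖ ^ k * ‖iteratedFDeriv ℝ m φ (z, w)‖) := by ring
    _ ≤ _ := by gcongr

lemma IsSchwartzInDifference.add {φ ψ : V g × V g → ℂ} (hφ : IsSchwartzInDifference φ)
    (hψ : IsSchwartzInDifference ψ) : IsSchwartzInDifference (φ + ψ) where
  smooth := hφ.smooth.add hψ.smooth
  decay K hK k m := by
    obtain ⟨C₁, h₁⟩ := hφ.decay K hK k m
    obtain ⟨C₂, h₂⟩ := hψ.decay K hK k m
    refine ⟨C₁ + C₂, fun z w hw => ?_⟩
    rw [iteratedFDeriv_add (hφ.smooth.of_le (by exact_mod_cast le_top))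
      (hψ.smooth.of_le (by exact_mod_cast le_top)), Pi.add_apply]
    calc _ ≤ ‖z - w‖ ^ k * (‖iteratedFDeriv ℝ m φ (z, w)‖ + ‖iteratedFDeriv ℝ m ψ (z, w)‖) := by
          gcongr; exact norm_add_le _ _
      _ ≤ _ := by rw [mul_add]; exact add_le_add (h₁ z w hw) (h₂ z w hw)

lemma IsSchwartzInDifference.zero : IsSchwartzInDifference (0 : V g × V g → ℂ) where
  smooth := contDiff_const
  decay K hK k m := ⟨0, fun z w _ => by simp⟩

lemma IsSchwartzInDifference.mul {φ ψ : V g × V g → ℂ} (hψ : IsTempered ψ)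
    (hφ : IsSchwartzInDifference φ) : IsSchwartzInDifference (ψ * φ) where
  smooth := hψ.smooth.mul hφ.smooth
  decay K hK k m := by
    choose C₁ k₁ h₁ using hψ.growth K hK
    choose C₂ h₂ using fun k m => hφ.decay_one_add hK k m
    refine ⟨∑ i ∈ Finset.range (m + 1), (m.choose i : ℝ) * |C₁ i| * C₂ (k + k₁ i) (m - i),
      fun z w hw => ?_⟩
    have e := norm_iteratedFDeriv_mul_le hψ.smooth hφ.smooth (z, w)
      (n := m) (by exact_mod_cast le_top)
    refine (mul_le_mul_of_nonneg_left e (by positivity)).trans ?_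
    rw [Finset.mul_sum]
    refine Finset.sum_le_sum fun i _ => ?_
    have r : ‖z - w‖ ≤ 1 + ‖z - w‖ := by linarith
    calc ‖z - w‖ ^ k * ((m.choose i : ℝ) * ‖iteratedFDeriv ℝ i ψ (z, w)‖
            * ‖iteratedFDeriv ℝ (m - i) φ (z, w)‖)
        ≤ (1 + ‖z - w‖) ^ k * ((m.choose i : ℝ) * (|C₁ i| * (1 + ‖z - w‖) ^ k₁ i)
            * ‖iteratedFDeriv ℝ (m - i) φ (z, w)‖) := by
          gcongr
          exact (h₁ i z w hw).trans (by gcongr; exact le_abs_self _)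
      _ = (m.choose i : ℝ) * |C₁ i| * ((1 + ‖z - w‖) ^ (k + k₁ i)
            * ‖iteratedFDeriv ℝ (m - i) φ (z, w)‖) := by ring
      _ ≤ _ := by gcongr; exact h₂ _ _ z w hw

lemma IsTempered.of_clm (L : V g × V g →L[ℝ] ℂ) : IsTempered L where
  smooth := L.contDiff
  growth K hK m := by
    obtain ⟨k, C, hC⟩ := L.hasTemperateGrowth.2 m
    obtain ⟨R, hR⟩ := hK.isBounded.exists_norm_le
    refine ⟨|C| * (1 + |R|) ^ k, k, fun z w hw => ?_⟩
    refine (hC (z, w)).trans ?_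
    have h₁ : ‖(z, w)‖ ≤ ‖z - w‖ + |R| := by
      have hw' := (hR w hw).trans (le_abs_self R)
      refine max_le ?_ (hw'.trans (by linarith [norm_nonneg (z - w)]))
      calc ‖z‖ = ‖(z - w) + w‖ := by simp
        _ ≤ ‖z - w‖ + ‖w‖ := norm_add_le _ _
        _ ≤ _ := by linarith
    rw [mul_assoc, ← mul_pow]
    have h₂ : 1 + ‖(z, w)‖ ≤ (1 + |R|) * (1 + ‖z - w‖) := by
      nlinarith [mul_nonneg (abs_nonneg R) (norm_nonneg (z - w))]
    gcongr
    exact le_abs_self C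

lemma IsTempered.of_linear (L : V g × V g →ₗ[ℝ] ℂ) : IsTempered (fun p => L p) :=
  IsTempered.of_clm (LinearMap.toContinuousLinearMap L)

lemma IsTempered.const (c : ℂ) : IsTempered (fun _ : V g × V g => c) where
  smooth := contDiff_const
  growth K hK m := by
    obtain ⟨k, C, hC⟩ := (Function.HasTemperateGrowth.const (E := V g) c).2 m
    refine ⟨‖c‖, 0, fun z w _ => ?_⟩
    rcases m with _ | m
    · simp
    · rw [iteratedFDeriv_const_of_ne (Nat.succ_ne_zero m)]
      simp

lemma IsTempered.of_snd {f : V g → ℂ} (hf : ContDiff ℝ ∞ f) :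
    IsTempered (fun p : V g × V g => f p.2) where
  smooth := hf.comp contDiff_snd
  growth K hK m := by
    obtain ⟨C, hC⟩ := hK.exists_bound_of_continuousOn
      (hf.continuous_iteratedFDeriv (m := m) (by exact_mod_cast le_top)).continuousOn
    refine ⟨C * ∏ _i : Fin m, ‖ContinuousLinearMap.snd ℝ (V g) (V g)‖, 0, fun z w hw => ?_⟩
    have e := (ContinuousLinearMap.snd ℝ (V g) (V g)).iteratedFDeriv_comp_right hf (z, w)
      (i := m) (by exact_mod_cast le_top)
    change ‖iteratedFDeriv ℝ m (f ∘ ⇑(ContinuousLinearMap.snd ℝ (V g) (V g))) (z, w)‖ ≤ _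
    rw [e, pow_zero, mul_one]
    refine (ContinuousMultilinearMap.norm_compContinuousLinearMap_le _ _).trans ?_
    gcongr
    exact hC w hw

lemma IsSchwartzInDifference.fderiv_apply {φ : V g × V g → ℂ} (h : IsSchwartzInDifference φ)
    (v : V g × V g) : IsSchwartzInDifference (fun p => fderiv ℝ φ p v) where
  smooth := (h.smooth.fderiv_right (m := ∞) (by simp)).clm_apply contDiff_const
  decay K hK k m := by
    obtain ⟨C, hC⟩ := h.decay K hK k (m + 1)
    refine ⟨‖v‖ * C, fun z w hw => ?_⟩
    have e := norm_iteratedFDeriv_clm_apply_const (𝕜 := ℝ) (f := fderiv ℝ φ) (c := v)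
      (x := (z, w)) (N := ∞) (n := m)
      (h.smooth.fderiv_right (m := ∞) (by simp)).contDiffAt (by exact_mod_cast le_top)
    rw [norm_iteratedFDeriv_fderiv] at e
    calc _ ≤ ‖z - w‖ ^ k * (‖v‖ * ‖iteratedFDeriv ℝ (m + 1) φ (z, w)‖) := by gcongr
      _ = ‖v‖ * (‖z - w‖ ^ k * ‖iteratedFDeriv ℝ (m + 1) φ (z, w)‖) := by ring
      _ ≤ _ := by gcongr; exact hC z w hw

lemma IsSchwartzInDifference.dbar {φ : V g × V g → ℂ} (h : IsSchwartzInDifference φ)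
    (j : Fin g) : IsSchwartzInDifference (dbar j φ) := by
  have e : MukaiTorus.dbar j φ = (fun _ => (1 / 2 : ℂ)) *
      ((fun p => fderiv ℝ φ p (Pi.single j 1, 0)) +
        (fun _ => Complex.I) * (fun p => fderiv ℝ φ p (Pi.single j Complex.I, 0))) := by
    funext p
    simp only [MukaiTorus.dbar, Pi.mul_apply, Pi.add_apply]
    ring
  rw [e]
  exact .mul (.const _) ((h.fderiv_apply _).add (.mul (.const _) (h.fderiv_apply _)))

/-- `v ↦ conj B_j(v)` as a real linear map. -/
def conjCoeffB (B : LinearMap.BilinForm ℝ (V g)) (j : Fin g) : V g →ₗ[ℝ] ℂ where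
  toFun v := starRingEnd ℂ (coeffB B j v)
  map_add' v w := by simp [coeffB]; ring
  map_smul' c v := by simp [coeffB]; ring

lemma isTempered_conjCoeffB_fst (B : LinearMap.BilinForm ℝ (V g)) (j : Fin g) :
    IsTempered (fun p : V g × V g => starRingEnd ℂ (coeffB B j p.1)) :=
  IsTempered.of_linear ((conjCoeffB B j).comp (LinearMap.fst ℝ (V g) (V g)))

lemma isTempered_conjCoeffB_sub (B : LinearMap.BilinForm ℝ (V g)) (j : Fin g) :
    IsTempered (fun p : V g × V g => starRingEnd ℂ (coeffB B j (p.2 - p.1))) :=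
  IsTempered.of_linear ((conjCoeffB B j).comp
    (LinearMap.snd ℝ (V g) (V g) - LinearMap.fst ℝ (V g) (V g)))

lemma isTempered_coord_sub (j : Fin g) :
    IsTempered (fun p : V g × V g => p.2 j - p.1 j) :=
  IsTempered.of_linear ((LinearMap.proj j).comp
    (LinearMap.snd ℝ (V g) (V g) - LinearMap.fst ℝ (V g) (V g)))

/-! The space of functions underlying `𝒴 = 𝒫 ⊗ 𝒬`. -/

/-- The space of `Λ`-invariant smooth functions on `V × V` that are Schwartz in `z - w`. -/
def invariantFunctions (Λ : Submodule ℤ (V g)) (B : LinearMap.BilinForm ℝ (V g)) :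
    Submodule ℂ (V g × V g → ℂ) where
  carrier := {φ | IsSchwartzInDifference φ ∧ IsInvariant Λ B φ}
  add_mem' := fun {a b} ha hb => ⟨ha.1.add hb.1, fun l hl z w => by
    simp only [Pi.add_apply, add_mul, ha.2 l hl z w, hb.2 l hl z w]⟩
  zero_mem' := ⟨.zero, fun l hl z w => by simp⟩
  smul_mem' := fun c a ha => ⟨IsSchwartzInDifference.mul (.const c) ha.1, fun l hl z w => by
    simp only [Pi.smul_apply, smul_eq_mul, mul_assoc, ha.2 l hl z w]⟩

variable {Λ : Submodule ℤ (V g)} {B : LinearMap.BilinForm ℝ (V g)}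

/-- The action of `𝒜(X)` through the second variable: `(f • φ)(z, w) = f(w) φ(z, w)`. -/
instance : SMul (smoothFunctions Λ) (invariantFunctions Λ B) where
  smul f φ := ⟨fun p => (f : V g → ℂ) p.2 * (φ : V g × V g → ℂ) p,
    IsSchwartzInDifference.mul (.of_snd f.2.1) φ.2.1, fun l hl z w => by
      dsimp only
      rw [f.2.2 l hl w, mul_assoc, φ.2.2 l hl z w]⟩

lemma smul_apply (f : smoothFunctions Λ) (φ : invariantFunctions Λ B) (p : V g × V g) :
    (f • φ : invariantFunctions Λ B).1 p = f.1 p.2 * φ.1 p := rfl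

instance : Module (smoothFunctions Λ) (invariantFunctions Λ B) where
  one_smul _ := Subtype.ext (funext fun _ => one_mul _)
  mul_smul _ _ _ := Subtype.ext (funext fun _ => mul_assoc _ _ _)
  smul_zero _ := Subtype.ext (funext fun _ => mul_zero _)
  smul_add _ _ _ := Subtype.ext (funext fun _ => mul_add _ _ _)
  add_smul _ _ _ := Subtype.ext (funext fun _ => add_mul _ _ _)
  zero_smul _ := Subtype.ext (funext fun _ => zero_mul _)

instance : IsScalarTower ℂ (smoothFunctions Λ) (invariantFunctions Λ B) where
  smul_assoc _ _ _ := Subtype.ext (funext fun _ => mul_assoc _ _ _)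

lemma hasFDerivAt_sigma (l w : V g) (z : V g) :
    HasFDerivAt (fun p : V g × V g => sigma B l (p.1 - p.2))
      (sigma B l (z - w) • (2 * Real.pi * Complex.I) •
        (Complex.ofRealCLM.comp ((LinearMap.toContinuousLinearMap (B l)).comp
          (ContinuousLinearMap.fst ℝ (V g) (V g) - ContinuousLinearMap.snd ℝ (V g) (V g)))))
      (z, w) := by
  have h := (Complex.ofRealCLM.comp ((LinearMap.toContinuousLinearMap (B l)).comp
    (ContinuousLinearMap.fst ℝ (V g) (V g) -
      ContinuousLinearMap.snd ℝ (V g) (V g)))).hasFDerivAt (x := (z, w))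
  exact (h.const_mul (2 * Real.pi * Complex.I)).cexp

/-- How the lattice action interacts with `∂/∂z̄_j`. -/
lemma IsInvariant.dbar {φ : V g × V g → ℂ} (hs : IsSchwartzInDifference φ)
    (h : IsInvariant Λ B φ) (j : Fin g) {l : V g} (hl : l ∈ Λ) (z w : V g) :
    dbar j φ (z + l, w + l) * sigma B l (z - w)
      + 2 * Real.pi * Complex.I * starRingEnd ℂ (coeffB B j l) * φ (z, w) = dbar j φ (z, w) := by
  have hφ : HasFDerivAt (fun p : V g × V g => φ (p + (l, l)))
      (fderiv ℝ φ (z + l, w + l)) (z, w) := by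
    have h₁ : HasFDerivAt φ (fderiv ℝ φ ((z, w) + (l, l))) ((z, w) + (l, l)) :=
      (hs.smooth.differentiable (by simp) _).hasFDerivAt
    exact h₁.comp (z, w) ((hasFDerivAt_id (z, w)).add_const (l, l))
  have hm := hφ.mul (hasFDerivAt_sigma (B := B) l w z)
  have he : (fun p : V g × V g => φ (p + (l, l)) * sigma B l (p.1 - p.2)) = φ :=
    funext fun p => h l hl p.1 p.2
  have hd := congrArg (fun F : V g × V g → ℂ => fderiv ℝ F (z, w)) he
  rw [show fderiv ℝ (fun p : V g × V g => φ (p + (l, l)) * sigma B l (p.1 - p.2)) (z, w) = _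
    from hm.fderiv] at hd
  have hv := h l hl z w
  have h2 : (starRingEnd ℂ) 2 = 2 := Complex.conj_ofNat 2
  simp only [MukaiTorus.dbar, coeffB, ← hd, ← hv]
  simp [h2]
  ring_nf

/-- The `dz̄_j`-component of `𝕐⁰`: the operator `φ ↦ ∂φ/∂z̄_j + 2πi conj(B_j(z)) φ`. -/
def nablaBar (Λ : Submodule ℤ (V g)) (B : LinearMap.BilinForm ℝ (V g)) (j : Fin g) :
    invariantFunctions Λ B →ₗ[smoothFunctions Λ] invariantFunctions Λ B where
  toFun φ := ⟨fun p => dbar j φ.1 p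
      + 2 * Real.pi * Complex.I * (starRingEnd ℂ (coeffB B j p.1) * φ.1 p),
    (φ.2.1.dbar j).add (.mul (.const _) (.mul (isTempered_conjCoeffB_fst B j) φ.2.1)),
    fun l hl z w => by
      dsimp only
      rw [← φ.2.2.dbar φ.2.1 j hl z w, ← φ.2.2 l hl z w,
        show starRingEnd ℂ (coeffB B j (z + l)) = starRingEnd ℂ (coeffB B j z)
          + starRingEnd ℂ (coeffB B j l) from (conjCoeffB B j).map_add z l]
      ring⟩
  map_add' φ ψ := by
    refine Subtype.ext (funext fun p => ?_)
    have h : fderiv ℝ (φ.1 + ψ.1) p = fderiv ℝ φ.1 p + fderiv ℝ ψ.1 p :=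
      fderiv_add (φ.2.1.smooth.differentiable (by simp) p)
        (ψ.2.1.smooth.differentiable (by simp) p)
    simp only [Submodule.coe_add, dbar, h, Pi.add_apply, add_apply]
    ring
  map_smul' f φ := by
    refine Subtype.ext (funext fun p => ?_)
    have hf : HasFDerivAt (fun p : V g × V g => f.1 p.2)
        ((fderiv ℝ f.1 p.2).comp (ContinuousLinearMap.snd ℝ (V g) (V g))) p :=
      HasFDerivAt.comp p (f.2.1.differentiable (by simp) p.2).hasFDerivAt hasFDerivAt_snd
    have h := (hf.mul (φ.2.1.smooth.differentiable (by simp) p).hasFDerivAt).fderiv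
    have h' : fderiv ℝ (f • φ).1 p = _ := h
    rw [RingHom.id_apply, smul_apply]
    simp only [dbar, h', smul_apply]
    simp
    ring

/-- The `dζ̄_j`-component of `𝕐⁰`: multiplication by `2πi (w_j - z_j)`. -/
def mulDiff (Λ : Submodule ℤ (V g)) (B : LinearMap.BilinForm ℝ (V g)) (j : Fin g) :
    invariantFunctions Λ B →ₗ[smoothFunctions Λ] invariantFunctions Λ B where
  toFun φ := ⟨fun p => 2 * Real.pi * Complex.I * ((p.2 j - p.1 j) * φ.1 p),
    .mul (.const _) (.mul (isTempered_coord_sub j) φ.2.1), fun l hl z w => by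
      dsimp only
      rw [← φ.2.2 l hl z w, Pi.add_apply, Pi.add_apply]
      ring⟩
  map_add' φ ψ := Subtype.ext (funext fun p => by
    simp only [Submodule.coe_add, Pi.add_apply]
    ring)
  map_smul' f φ := Subtype.ext (funext fun p => by
    simp only [smul_apply, RingHom.id_apply]
    ring)

/-- The `dz̄_j`-component of `Φ`: multiplication by `2πi conj(B_j(w - z))`. -/
def mulPhi (Λ : Submodule ℤ (V g)) (B : LinearMap.BilinForm ℝ (V g)) (j : Fin g) :
    invariantFunctions Λ B →ₗ[smoothFunctions Λ] invariantFunctions Λ B where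
  toFun φ := ⟨fun p => 2 * Real.pi * Complex.I * (starRingEnd ℂ (coeffB B j (p.2 - p.1)) * φ.1 p),
    .mul (.const _) (.mul (isTempered_conjCoeffB_sub B j) φ.2.1), fun l hl z w => by
      dsimp only
      rw [← φ.2.2 l hl z w, add_sub_add_right_eq_sub]
      ring⟩
  map_add' φ ψ := Subtype.ext (funext fun p => by
    simp only [Submodule.coe_add, Pi.add_apply]
    ring)
  map_smul' f φ := Subtype.ext (funext fun p => by
    simp only [smul_apply, RingHom.id_apply]
    ring)

/-! The graded module `𝒴` with its operator, and its cohomology. -/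

/-- The space `V^{0,1} ⊕ V_{1,0}` in coordinates, with basis `dz̄₁, …, dz̄_g, dζ̄₁, …, dζ̄_g`; its
exterior algebra is `Λ^• V^{0,1} ⊗ Λ^• V_{1,0}` with the total grading. -/
abbrev Covectors (g : ℕ) : Type := (Fin g → ℂ) × (Fin g → ℂ)

/-- The basis vector `dz̄_j` of `V^{0,1}`. -/
def dzBar (j : Fin g) : Covectors g := (Pi.single j 1, 0)

/-- The basis vector `dζ̄_j` of `V_{1,0}`. -/
def dzetaBar (j : Fin g) : Covectors g := (0, Pi.single j 1)

/-- The wedge product `θ ∧ ·`, in degree `n`. -/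
def wedge (n : ℕ) (θ : Covectors g) :
    ⋀[ℂ]^n (Covectors g) →ₗ[ℂ] ⋀[ℂ]^(n + 1) (Covectors g) :=
  (LinearMap.mulLeft ℂ (ExteriorAlgebra.ι ℂ θ)).restrict fun x hx => by
    change _ ∈ LinearMap.range (ExteriorAlgebra.ι ℂ) ^ (n + 1)
    rw [pow_succ']
    exact Submodule.mul_mem_mul ⟨θ, rfl⟩ hx

/-- The degree `n` part of `𝒴`, as a module over `𝒜(X)`: the invariant forms of total degree `n`
that are Schwartz in `z - w`. -/
abbrev Y (Λ : Submodule ℤ (V g)) (B : LinearMap.BilinForm ℝ (V g)) (n : ℕ) : Type :=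
  invariantFunctions Λ B ⊗[ℂ] ⋀[ℂ]^n (Covectors g)

instance : Ring (smoothFunctions Λ) := inferInstance

instance (n : ℕ) : AddCommGroup (Y Λ B n) := inferInstance

/-- The operator `𝕐⁰`, i.e. `φ ↦ ∑ j, dz̄_j ∧ (∂φ/∂z̄_j + 2πi conj(B_j(z)) φ)
+ ∑ j, 2πi (w_j - z_j) dζ̄_j ∧ φ`. -/
def Y₀ (Λ : Submodule ℤ (V g)) (B : LinearMap.BilinForm ℝ (V g)) (n : ℕ) :
    Y Λ B n →ₗ[smoothFunctions Λ] Y Λ B (n + 1) :=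
  ∑ j, (TensorProduct.AlgebraTensorModule.map (nablaBar Λ B j) (wedge n (dzBar j))
    + TensorProduct.AlgebraTensorModule.map (mulDiff Λ B j) (wedge n (dzetaBar j)))

/-- The operator `Φ`, i.e. `φ ↦ 2πi ∑ j, conj(B_j(w - z)) dz̄_j ∧ φ`. -/
def Phi (Λ : Submodule ℤ (V g)) (B : LinearMap.BilinForm ℝ (V g)) (n : ℕ) :
    Y Λ B n →ₗ[smoothFunctions Λ] Y Λ B (n + 1) :=
  ∑ j, TensorProduct.AlgebraTensorModule.map (mulPhi Λ B j) (wedge n (dzBar j))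

/-- The gauge-corrected operator `𝕐⁰ + Φ`. -/
def differential (Λ : Submodule ℤ (V g)) (B : LinearMap.BilinForm ℝ (V g)) (n : ℕ) :
    Y Λ B n →ₗ[smoothFunctions Λ] Y Λ B (n + 1) :=
  Y₀ Λ B n + Phi Λ B n

/-- The cocycles of degree `n`. -/
abbrev cocycles (Λ : Submodule ℤ (V g)) (B : LinearMap.BilinForm ℝ (V g)) (n : ℕ) :
    Submodule (smoothFunctions Λ) (Y Λ B n) :=
  LinearMap.ker (differential Λ B n)

/-- The coboundaries of degree `n`. -/
def coboundaries (Λ : Submodule ℤ (V g)) (B : LinearMap.BilinForm ℝ (V g)) :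
    (n : ℕ) → Submodule (smoothFunctions Λ) (Y Λ B n)
  | 0 => ⊥
  | n + 1 => LinearMap.range (differential Λ B n)


/-- The cohomology of `(𝒴, 𝕐⁰ + Φ)` in degree `n`, a module over `𝒜(X)`. -/
abbrev cohomology (Λ : Submodule ℤ (V g)) (B : LinearMap.BilinForm ℝ (V g)) (n : ℕ) : Type :=
  cocycles Λ B n ⧸ (coboundaries Λ B n).submoduleOf (cocycles Λ B n)

/-- The form `(dz̄₁ + i dζ̄₁) ∧ ⋯ ∧ (dz̄_g + i dζ̄_g)`. -/
def topPlusForm (g : ℕ) : ⋀[ℂ]^g (Covectors g) :=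
  exteriorPower.ιMulti ℂ g fun j => dzBar j + Complex.I • dzetaBar j

end MukaiTorus

end

open scoped ContDiff TensorProduct

noncomputable section

namespace MukaiTorus

section

/-! Homotopies in a ring with anticommuting elements. -/

section Ring

variable {R ι : Type*} [Ring R]

/-! Replace the basis `dz̄_j, dζ̄_j` by `dz̄_j, e⁺_j` with `e⁺_j = dz̄_j + i dζ̄_j`. The
differential becomes `∑ j, (D_j dz̄_j ∧ · + v_j e⁺_j ∧ ·)`, where `v_j` is multiplication by `-2π
(z_j - w_j)` and `D_j = ∂/∂z̄_j + 2πi conj(B_j(w)) + 2π (z_j - w_j)`: the term `Φ` has turned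
`B_j(z)` into `B_j(w)`. The Gaussian `a` is killed by every `D_j` and vanishes nowhere, so `D_j = a
∘ ∂/∂z̄_j ∘ a⁻¹` (`reduced_barOp`). Moreover `a` carries the automorphy factor of the lattice, so `ψ
= φ / a` is plainly invariant under diagonal translations. What remains is the Koszul complex of the
commuting operators `∂/∂z̄_j` and `u_j = z_j - w_j`. Heuristically, `∂̄` leaves the functions
holomorphic in `z`, and dividing by the `u_j` leaves their values on the diagonal, placed on `e⁺₁ ∧
⋯ ∧ e⁺_g`.

Since `φ / a` may grow like a Gaussian, this is carried out by explicit homotopies that respect the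
Schwartz condition. Scale `u_j` by `s` in `[0, 1]` with `w` fixed, and let `A_k` be the average of
the scaled function with weight `s^k`. The fundamental theorem of calculus in `s` reads `ψ - ψ|_{u_j
= 0} = u_j A_0 (∂ψ/∂z_j) + conj(u_j) A_0 (∂ψ/∂z̄_j)`, together with weighted versions
(`averageOp_ftc`). From `A_0` and `A_1` one builds a homotopy `h_j` with `d h_j + h_j d = 1 - P_j`
(`koszul_relations`, `koszulHomotopy_spec`), where `P_j` restricts to `z_j = w_j` and projects to
the forms `e⁺_j ∧ y` with `y` free of `dz̄_j` and `e⁺_j`. The summands of `d` with other indices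
anticommute with `h_j`.

The averages preserve the Schwartz estimates (`hasDecay_average`, `decayOrder_average`) because the
ratio of the Gaussian at a point to the Gaussian at the scaled point is `exp(-2π (1 - s²) |u_j|²)`
in absolute value: for small `s` this factor gives the decay, for `s` near `1` the decay of `φ`
itself does. All operators are linear over functions of `w`, as `w` never moves.

The `h_j` combine to a homotopy from `1` to `Π = ∏ j, P_j` (`exists_homotopy_list_prod`). The
operator `Π` sends every form to a multiple of the generator (`exists_projPart_list_eq_smul`), which
gives generation in degree `g` and vanishing in all other degrees. It also commutes with `d` and
fixes the generator, which gives freeness (`smul_generator_eq_diffTotal`). -/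

lemma anticomm_sum_left {s : Finset ι} {d : ι → R} {h : R}
    (H : ∀ i ∈ s, d i * h + h * d i = 0) : (∑ i ∈ s, d i) * h + h * ∑ i ∈ s, d i = 0 := by
  rw [Finset.sum_mul, Finset.mul_sum, ← Finset.sum_add_distrib]
  exact Finset.sum_eq_zero H

/-- Homotopies from `1` to `P j` combine to a homotopy from `1` to the product of the `P j`. -/
lemma exists_homotopy_list_prod {d : R} (hd : d * d = 0) {h P : ι → R}
    (H : ∀ j, d * h j + h j * d = 1 - P j) (l : List ι) :
    ∃ k, d * k + k * d = 1 - (l.map P).prod := by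
  induction l with
  | nil => exact ⟨0, by simp⟩
  | cons j l ih =>
    obtain ⟨k, hk⟩ := ih
    -- Both sides of the homotopy formula commute with `d` because `d * d = 0`, so a projection
    -- homotopic to `1` is a chain map.
    have hc : d * P j = P j * d := by
      have e : P j = 1 - (d * h j + h j * d) := by rw [H j]; abel
      have e₁ : d * (d * h j) = 0 := by rw [← mul_assoc, hd, zero_mul]
      have e₂ : h j * d * d = 0 := by rw [mul_assoc, hd, mul_zero]
      rw [e, mul_sub, sub_mul, mul_add, add_mul, e₁, e₂, mul_assoc]
      simp
    -- The two contributions telescope: `(1 - P j) + P j (1 - Q) = 1 - P j Q`, with `Q` the product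
    -- over the tail.
    refine ⟨h j + P j * k, ?_⟩
    rw [List.map_cons, List.prod_cons, mul_add, add_mul, ← mul_assoc, hc]
    calc d * h j + P j * d * k + (h j * d + P j * k * d)
        = (d * h j + h j * d) + P j * (d * k + k * d) := by noncomm_ring
      _ = 1 - P j * (l.map P).prod := by rw [H j, hk]; noncomm_ring

/-- The differential commutes with each product of operators homotopic to `1`. -/
lemma comm_list_prod_of_homotopy {d : R} (hd : d * d = 0) {h P : ι → R}
    (H : ∀ j, d * h j + h j * d = 1 - P j) (l : List ι) :
    d * (l.map P).prod = (l.map P).prod * d := by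
  obtain ⟨k, hk⟩ := exists_homotopy_list_prod hd H l
  have e : (l.map P).prod = 1 - (d * k + k * d) := by rw [hk]; abel
  have e₁ : d * (d * k) = 0 := by rw [← mul_assoc, hd, zero_mul]
  have e₂ : k * d * d = 0 := by rw [mul_assoc, hd, mul_zero]
  rw [e, mul_sub, sub_mul, mul_add, add_mul, e₁, e₂, mul_assoc]
  simp

/-- The relations needed for the homotopy of a Koszul complex, from the relations between scaling
averages `A k`, multiplications and derivatives. -/
lemma koszul_relations [Algebra ℂ R] {D v w δ E₀ : R} {A : ℕ → R} {c t : ℂ} (hct : c * -t = 1)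
    (hvw : v * w = w * v) (hDδ : D * δ = δ * D) (hDw : D * w = 1 + w * D)
    (hδv : δ * v = v * δ - t • 1) (hAv : ∀ k, A k * v = v * A (k + 1))
    (hDA : ∀ k, D * A k = A (k + 1) * D)
    (h₀ : A 0 + w * A 1 * D + c • (v * A 1 * δ) = 1)
    (h₁ : (2 : ℂ) • A 1 + w * A 2 * D + c • (v * A 2 * δ) = 1)
    (hE : E₀ = 1 - (v * c • (A 0 * δ) + w * A 0 * D)) :
    (w * A 1 * D + c • (A 0 * δ) * v = 1) ∧ (D * (w * A 1) + c • (A 1 * δ) * v = 1) ∧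
    (v * (w * A 1) = w * A 0 * v) ∧ (D * c • (A 0 * δ) = c • (A 1 * δ) * D) ∧
    (v * c • (A 0 * δ) + w * A 0 * D = 1 - E₀) ∧ (D * (w * A 0) + v * c • (A 1 * δ) = 1) := by
  -- Moving `v` to the left past `δ` produces the commutator, which `c` normalises to `A k`; moving
  -- it past `A k` raises the weight by one.
  have hδ : ∀ k, c • (A k * δ) * v = A k + c • (v * A (k + 1) * δ) := by
    intro k
    rw [smul_mul_assoc, mul_assoc, hδv, mul_sub, smul_sub, ← mul_assoc, hAv, mul_smul_comm,
      smul_smul, mul_one, sub_eq_add_neg, ← neg_smul, ← mul_neg, hct, one_smul, add_comm]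
  refine ⟨?_, ?_, ?_, ?_, ?_, ?_⟩
  · rw [hδ, ← h₀]
    abel
  -- Each of the two commutators `[D, w]` and `[δ, v]` contributes one `A 1`, which accounts for the
  -- coefficient `2` in `h₁`.
  · rw [hδ, ← mul_assoc, hDw, add_mul, one_mul, mul_assoc w, hDA, ← h₁, two_smul, mul_assoc w]
    abel
  · rw [← mul_assoc, hvw, mul_assoc, mul_assoc, hAv]
  · rw [mul_smul_comm, smul_mul_assoc, ← mul_assoc, hDA, mul_assoc, mul_assoc, hDδ]
  · rw [hE, sub_sub_cancel]
  · rw [mul_smul_comm, ← mul_assoc, ← mul_assoc, hDw, add_mul, one_mul, mul_assoc w D, hDA, ← h₀,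
      mul_assoc w]

/-- A sum of anticommuting elements of square zero has square zero. -/
lemma sum_mul_self_eq_zero [Algebra ℂ R] [Fintype ι] {d : ι → R}
    (h : ∀ i j, d i * d j + d j * d i = 0) : (∑ i, d i) * ∑ i, d i = 0 := by
  have h₁ : ∀ j, (∑ i, d i) * d j + d j * ∑ i, d i = 0 := fun j =>
    anticomm_sum_left fun i _ => h i j
  have h₂ : (∑ i, d i) * (∑ i, d i) + (∑ i, d i) * ∑ i, d i = 0 := by
    conv_lhs => enter [1]; rw [Finset.mul_sum]
    conv_lhs => enter [2]; rw [Finset.sum_mul]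
    rw [← Finset.sum_add_distrib]
    exact Finset.sum_eq_zero fun j _ => h₁ j
  -- Anticommutation of the sum with itself only shows that twice the square vanishes; the
  -- `ℂ`-algebra structure allows division by `2`.
  have h₃ : (2 : ℂ) • ((∑ i, d i) * ∑ i, d i) = 0 := by rw [two_smul, h₂]
  calc _ = (2⁻¹ : ℂ) • (2 : ℂ) • ((∑ i, d i) * ∑ i, d i) := by
        rw [smul_smul, inv_mul_cancel₀ two_ne_zero, one_smul]
    _ = 0 := by rw [h₃, smul_zero]

end Ring

/-! ### Koszul homotopies on a tensor product of functions and forms. -/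

section Tensor

variable {A W E : Type*} [CommRing A] [Algebra ℂ A] [AddCommGroup W] [Module A W] [Module ℂ W]
  [IsScalarTower ℂ A W] [AddCommGroup E] [Module ℂ E]

/-- The operator `P ⊗ x` on `W ⊗ E`. -/
abbrev tensorOp (P : Module.End A W) (x : Module.End ℂ E) : Module.End A (W ⊗[ℂ] E) :=
  TensorProduct.AlgebraTensorModule.map P x

lemma tensorOp_mul (P Q : Module.End A W) (x y : Module.End ℂ E) :
    tensorOp P x * tensorOp Q y = tensorOp (P * Q) (x * y) :=
  (TensorProduct.AlgebraTensorModule.map_mul P Q x y).symm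

lemma tensorOp_neg_right (P : Module.End A W) (x : Module.End ℂ E) :
    tensorOp P (-x) = -tensorOp P x := by
  rw [eq_neg_iff_add_eq_zero, ← TensorProduct.AlgebraTensorModule.map_add_right, neg_add_cancel]
  exact (TensorProduct.AlgebraTensorModule.homTensorHomMap ℂ A A W E W E).map_zero ▸
    LinearMap.ext fun t => by
      induction t using TensorProduct.induction_on <;> simp_all

lemma tensorOp_zero_right (P : Module.End A W) : tensorOp P (0 : Module.End ℂ E) = 0 := by
  have := tensorOp_neg_right P (0 : Module.End ℂ E)
  have h2 := TensorProduct.AlgebraTensorModule.map_add_right P (0 : Module.End ℂ E) 0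
  rw [add_zero] at h2
  exact left_eq_add.1 h2

lemma tensorOp_list_prod {ι : Type*} (P : ι → Module.End A W) (x : ι → Module.End ℂ E)
    (l : List ι) :
    (l.map fun i => tensorOp (P i) (x i)).prod = tensorOp (l.map P).prod (l.map x).prod := by
  induction l with
  | nil => exact TensorProduct.AlgebraTensorModule.map_one.symm
  | cons i l ih => simp only [List.map_cons, List.prod_cons, ih, tensorOp_mul]

lemma tensorOp_anticomm {P Q : Module.End A W} {x y : Module.End ℂ E} (h : Commute P Q)
    (h' : x * y = -(y * x)) :
    tensorOp P x * tensorOp Q y + tensorOp Q y * tensorOp P x = 0 := by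
  rw [tensorOp_mul, tensorOp_mul, h', h.eq, tensorOp_neg_right, neg_add_cancel]

lemma tensorOp_add_anticomm {D v D' v' : Module.End A W} {z e z' e' : Module.End ℂ E}
    (h₁ : Commute D D') (h₂ : Commute D v') (h₃ : Commute v D') (h₄ : Commute v v')
    (k₁ : z * z' = -(z' * z)) (k₂ : z * e' = -(e' * z)) (k₃ : e * z' = -(z' * e))
    (k₄ : e * e' = -(e' * e)) :
    (tensorOp D z + tensorOp v e) * (tensorOp D' z' + tensorOp v' e')
      + (tensorOp D' z' + tensorOp v' e') * (tensorOp D z + tensorOp v e) = 0 := by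
  have := congrArg₂ (· + ·)
    (congrArg₂ (· + ·) (tensorOp_anticomm h₁ k₁) (tensorOp_anticomm h₂ k₂))
    (congrArg₂ (· + ·) (tensorOp_anticomm h₃ k₃) (tensorOp_anticomm h₄ k₄))
  simp only [add_zero] at this
  rw [← this]
  simp only [mul_add, add_mul]
  abel

/-- The homotopy for the Koszul complex of a pair of commuting operators `D`, `v`. -/
def koszulHomotopy (X₁ X₂ Y₁ Y₂ : Module.End A W) (z e p r : Module.End ℂ E) :
    Module.End A (W ⊗[ℂ] E) :=
  tensorOp X₂ (p * (r * e)) + tensorOp X₁ (p * (e * r)) + tensorOp Y₁ (r * (p * z))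
    + tensorOp Y₂ (r * (z * p))

/-- Here `z`, `e` are the wedge operators of two covectors and `p`, `r` the dual contractions, so `p
z`, `z p`, `r e`, `e r` project to the forms that omit or contain one of the covectors. The homotopy
contracts the first covector with coefficient `X₂` or `X₁`, and the second with `Y₁` or `Y₂`,
according to whether the other covector is absent or present. The hypotheses are the matrix entries
of the identity on the four-term complex: `h₁` in degree 0, `h₂` and `h₅` the diagonal and `h₃`,
`h₄` the off-diagonal entries in degree 1, and `h₆` in degree 2. The defect `E₀` sits only on forms
containing the second covector and not the first. -/
lemma koszulHomotopy_spec {D v X₁ X₂ Y₁ Y₂ E₀ : Module.End A W} {z e p r : Module.End ℂ E}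
    (hz : z * z = 0) (he : e * e = 0)
    (hez : e * z = -(z * e)) (hrp : r * p = -(p * r)) (hpz : p * z = 1 - z * p)
    (hre : r * e = 1 - e * r) (hpe : p * e = -(e * p)) (hrz : r * z = -(z * r))
    (h₁ : X₂ * D + Y₁ * v = 1) (h₂ : D * X₂ + Y₂ * v = 1) (h₃ : v * X₂ = X₁ * v)
    (h₄ : D * Y₁ = Y₂ * D) (h₅ : v * Y₁ + X₁ * D = 1 - E₀) (h₆ : D * X₁ + v * Y₂ = 1) :
    (tensorOp D z + tensorOp v e) * koszulHomotopy X₁ X₂ Y₁ Y₂ z e p r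
      + koszulHomotopy X₁ X₂ Y₁ Y₂ z e p r * (tensorOp D z + tensorOp v e)
      = 1 - tensorOp E₀ (p * z * (e * r)) := by
  have a {x y w : Module.End ℂ E} (h : x * y = w) (t) : x * (y * t) = w * t := by
    rw [← mul_assoc, h]
  have w₁ : z * (p * (r * e)) = z * p * (r * e) := (mul_assoc _ _ _).symm
  have w₂ : z * (p * (e * r)) = z * p * (e * r) := (mul_assoc _ _ _).symm
  have w₃ : z * (r * (p * z)) = -(r * z) := by
    simp only [hpz, hrz, mul_sub, mul_one, a hrz, mul_neg, neg_mul, mul_assoc, a hz, zero_mul]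
    simp
  have w₄ : z * (r * (z * p)) = 0 := by
    simp only [a hrz, mul_neg, neg_mul, mul_assoc, a hz, zero_mul, neg_zero]
  have w₅ : e * (p * (r * e)) = -(p * e) := by
    simp only [hre, hpe, mul_sub, mul_one, a hpe, mul_neg, neg_mul, mul_assoc, a he, zero_mul]
    simp
  have w₆ : e * (p * (e * r)) = 0 := by
    simp only [a hpe, mul_neg, neg_mul, mul_assoc, a he, zero_mul, neg_zero]
  have s₁ : r * (p * z) = p * z * r := by
    rw [a hrp, neg_mul, mul_assoc, hrz, mul_neg, neg_neg, mul_assoc]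
  have s₂ : r * (z * p) = z * p * r := by
    rw [a hrz, neg_mul, mul_assoc, hrp, mul_neg, neg_neg, mul_assoc]
  have s₃ : e * (p * z) = p * z * e := by
    rw [a (show e * p = -(p * e) by rw [hpe, neg_neg]), neg_mul,
      mul_assoc, hez, mul_neg, neg_neg, mul_assoc]
  have s₄ : e * (z * p) = z * p * e := by
    rw [a hez, neg_mul, mul_assoc, show e * p = -(p * e) by rw [hpe, neg_neg], mul_neg, neg_neg,
      mul_assoc]
  have w₇ : e * (r * (p * z)) = p * z * (e * r) := by
    rw [s₁, ← mul_assoc e, s₃, mul_assoc (p * z)]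
  have w₈ : e * (r * (z * p)) = z * p * (e * r) := by
    rw [s₂, ← mul_assoc e, s₄, mul_assoc (z * p)]
  have w₉ : p * (r * e) * z = p * z * (r * e) := by
    rw [mul_assoc, mul_assoc r, hez, mul_neg, a hrz, neg_mul, neg_neg, mul_assoc, mul_assoc]
  have w₁₀ : p * (e * r) * z = p * z * (e * r) := by
    rw [mul_assoc, mul_assoc e, hrz, mul_neg, a hez, neg_mul, neg_neg, mul_assoc, mul_assoc]
  have w₁₁ : r * (p * z) * z = 0 := by simp only [mul_assoc, hz, mul_zero]
  have w₁₂ : r * (z * p) * z = r * z := by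
    rw [mul_assoc, mul_assoc, hpz, mul_sub, mul_one, a hz, zero_mul, sub_zero]
  have w₁₃ : p * (r * e) * e = 0 := by simp only [mul_assoc, he, mul_zero]
  have w₁₄ : p * (e * r) * e = p * e := by
    rw [mul_assoc, mul_assoc, hre, mul_sub, mul_one, a he, zero_mul, sub_zero]
  have w₁₅ : r * (p * z) * e = p * z * (r * e) := by rw [s₁, mul_assoc]
  have w₁₆ : r * (z * p) * e = z * p * (r * e) := by rw [s₂, mul_assoc]
  have key : ∀ {P Q P' : Module.End A W} (x : Module.End ℂ E), P + Q = P' →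
      tensorOp P x + tensorOp Q x = tensorOp P' x := fun x h => by
    rw [← h, tensorOp, tensorOp, ← TensorProduct.AlgebraTensorModule.map_add_left]
  -- The identity is resolved into the four projections that record which of the two covectors
  -- occur, and each piece is then matched with one of `h₁`, `h₂`, `h₅`, `h₆`.
  have one : (1 : Module.End A (W ⊗[ℂ] E)) = tensorOp 1 (z * p * (r * e))
      + tensorOp 1 (z * p * (e * r)) + tensorOp 1 (p * z * (r * e))
      + (tensorOp E₀ (p * z * (e * r)) + tensorOp (1 - E₀) (p * z * (e * r))) := by
    rw [key _ (add_sub_cancel E₀ 1), ← TensorProduct.AlgebraTensorModule.map_add_right,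
      ← TensorProduct.AlgebraTensorModule.map_add_right,
      ← TensorProduct.AlgebraTensorModule.map_add_right, hre, hpz]
    rw [← TensorProduct.AlgebraTensorModule.map_one]
    congr 1
    noncomm_ring
  rw [one, ← key (p * z * (r * e)) h₁, ← key (z * p * (r * e)) h₂, ← key _ h₅,
    ← key (z * p * (e * r)) h₆]
  simp only [koszulHomotopy, mul_add, add_mul, tensorOp_mul, w₁, w₂, w₃, w₄, w₅, w₆, w₇, w₈, w₉,
    w₁₀, w₁₁, w₁₂, w₁₃, w₁₄, w₁₅, w₁₆, tensorOp_neg_right, tensorOp_zero_right, h₃, h₄]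
  abel

/-- Every term of the homotopy involves a product of three odd operators, so an odd operator that
anticommutes with each factor anticommutes with the product; the coefficients commute. -/
lemma koszulHomotopy_anticomm {D v X₁ X₂ Y₁ Y₂ : Module.End A W} {z e p r z' e' : Module.End ℂ E}
    (hD : ∀ T ∈ [X₁, X₂, Y₁, Y₂], Commute D T) (hv : ∀ T ∈ [X₁, X₂, Y₁, Y₂], Commute v T)
    (hz : ∀ t ∈ [z, e, p, r], z' * t = -(t * z')) (he : ∀ t ∈ [z, e, p, r], e' * t = -(t * e')) :
    (tensorOp D z' + tensorOp v e') * koszulHomotopy X₁ X₂ Y₁ Y₂ z e p r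
      + koszulHomotopy X₁ X₂ Y₁ Y₂ z e p r * (tensorOp D z' + tensorOp v e') = 0 := by
  have triple {x a b c : Module.End ℂ E} (ha : x * a = -(a * x)) (hb : x * b = -(b * x))
      (hc : x * c = -(c * x)) : x * (a * (b * c)) = -(a * (b * c) * x) := by
    rw [← mul_assoc, ha, neg_mul, mul_assoc, ← mul_assoc x, hb, neg_mul, mul_assoc, hc]
    simp [mul_assoc]
  simp only [List.forall_mem_cons, List.not_mem_nil, false_imp_iff, implies_true, and_true]
    at hD hv hz he
  obtain ⟨d₁, d₂, d₃, d₄⟩ := hD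
  obtain ⟨v₁, v₂, v₃, v₄⟩ := hv
  obtain ⟨z₁, z₂, z₃, z₄⟩ := hz
  obtain ⟨e₁, e₂, e₃, e₄⟩ := he
  have t₁ := tensorOp_anticomm d₂ (triple z₃ z₄ z₂)
  have t₂ := tensorOp_anticomm d₁ (triple z₃ z₂ z₄)
  have t₃ := tensorOp_anticomm d₃ (triple z₄ z₃ z₁)
  have t₄ := tensorOp_anticomm d₄ (triple z₄ z₁ z₃)
  have t₅ := tensorOp_anticomm v₂ (triple e₃ e₄ e₂)
  have t₆ := tensorOp_anticomm v₁ (triple e₃ e₂ e₄)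
  have t₇ := tensorOp_anticomm v₃ (triple e₄ e₃ e₁)
  have t₈ := tensorOp_anticomm v₄ (triple e₄ e₁ e₃)
  have := congrArg₂ (· + ·) (congrArg₂ (· + ·) (congrArg₂ (· + ·) t₁ t₂) (congrArg₂ (· + ·) t₃ t₄))
    (congrArg₂ (· + ·) (congrArg₂ (· + ·) t₅ t₆) (congrArg₂ (· + ·) t₇ t₈))
  simp only [add_zero] at this
  rw [← this, koszulHomotopy]
  simp only [mul_add, add_mul]
  abel

end Tensor

/-! The canonical anticommutation relations. -/

section CAR

/-- The integer is a sign depending on the length of the list. Its value never matters: the lemma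
serves to move an operator to a place where it acts by zero, or to collect signs into an unspecified
factor. -/
lemma exists_comm_list_prod {ι S : Type*} [Ring S] {x : S} {e : ι → S} {l : List ι}
    (h : ∀ i ∈ l, x * e i = -(e i * x)) :
    ∃ c : ℤ, x * (l.map e).prod = c • ((l.map e).prod * x) := by
  induction l with
  | nil => exact ⟨1, by simp⟩
  | cons i l ih =>
    obtain ⟨c, hc⟩ := ih fun i hi => h i (List.mem_cons_of_mem _ hi)
    refine ⟨-c, ?_⟩
    rw [List.map_cons, List.prod_cons, ← mul_assoc, h i List.mem_cons_self, neg_mul, mul_assoc, hc,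
      mul_smul_comm, neg_smul, mul_assoc]

/-- Creation operators `z j`, `e j` and annihilation operators `p j`, `r j` satisfying the canonical
anticommutation relations. -/
structure CAR {ι S : Type*} [DecidableEq ι] [Ring S] (z e p r : ι → S) : Prop where
  zz : ∀ i j, z i * z j = -(z j * z i)
  ze : ∀ i j, z i * e j = -(e j * z i)
  ee : ∀ i j, e i * e j = -(e j * e i)
  pp : ∀ i j, p i * p j = -(p j * p i)
  rp : ∀ i j, r i * p j = -(p j * r i)
  pr : ∀ i j, p i * r j = -(r j * p i)
  rr : ∀ i j, r i * r j = -(r j * r i)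
  pz : ∀ i j, p i * z j = (if i = j then 1 else 0) - z j * p i
  re : ∀ i j, r i * e j = (if i = j then 1 else 0) - e j * r i
  pe : ∀ i j, p i * e j = -(e j * p i)
  rz : ∀ i j, r i * z j = -(z j * r i)
  z_sq : ∀ i, z i * z i = 0
  e_sq : ∀ i, e i * e i = 0
  p_sq : ∀ i, p i * p i = 0
  r_sq : ∀ i, r i * r i = 0

variable {ι S : Type*} [DecidableEq ι] [Ring S] {z e p r : ι → S}

lemma CAR.e_mul_list_prod (H : CAR z e p r) {j : ι} {l : List ι} (hj : j ∈ l) :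
    e j * (l.map e).prod = 0 := by
  induction l with
  | nil => simp at hj
  | cons i l ih =>
    rw [List.map_cons, List.prod_cons, ← mul_assoc]
    rcases List.mem_cons.1 hj with rfl | hj
    · rw [H.e_sq, zero_mul]
    · rw [H.ee, neg_mul, mul_assoc, ih hj, mul_zero, neg_zero]

lemma CAR.proj_eq (H : CAR z e p r) (j : ι) :
    p j * z j * (e j * r j) = e j * (p j * z j * r j) := by
  have h : p j * z j * e j = e j * (p j * z j) := by
    rw [mul_assoc, H.ze, mul_neg, ← mul_assoc, H.pe, neg_mul, neg_neg, mul_assoc]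
  rw [← mul_assoc, h, mul_assoc]

/-- The product of the projections onto the `e j`-parts factors through the vectors killed by the
annihilation operators. -/
lemma CAR.exists_proj_list (H : CAR z e p r) (l : List ι) (hl : l.Nodup) :
    ∃ y, (l.map fun j => p j * z j * (e j * r j)).prod = (l.map e).prod * y ∧
      ∀ i ∈ l, p i * y = 0 ∧ r i * y = 0 := by
  induction l with
  | nil => exact ⟨1, by simp⟩
  | cons j l ih =>
    rw [List.nodup_cons] at hl
    obtain ⟨y, hy, hy'⟩ := ih hl.2
    obtain ⟨c₁, h₁⟩ := exists_comm_list_prod (x := r j) (e := e) (l := l) fun i hi => by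
      rw [H.re, if_neg (ne_of_mem_of_not_mem hi hl.1).symm, zero_sub]
    obtain ⟨c₂, h₂⟩ := exists_comm_list_prod (x := z j) (e := e) (l := l) fun i _ => H.ze j i
    obtain ⟨c₃, h₃⟩ := exists_comm_list_prod (x := p j) (e := e) (l := l) fun i _ => H.pe j i
    -- The factors `p j`, `z j`, `r j` are pushed to the right through the creation operators of the
    -- remaining indices, leaving `e j` in front; `c₁`, `c₂`, `c₃` are the signs picked up.
    refine ⟨(c₁ * c₂ * c₃) • (p j * z j * r j * y), ?_, ?_⟩
    · have e' : p j * z j * r j * (l.map e).prod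
          = (c₁ * c₂ * c₃) • ((l.map e).prod * (p j * z j * r j)) := by
        rw [mul_assoc, h₁, mul_smul_comm, mul_assoc, ← mul_assoc (z j), h₂, smul_mul_assoc,
          mul_smul_comm, mul_assoc (l.map e).prod, ← mul_assoc (p j), h₃, smul_mul_assoc,
          smul_smul, smul_smul]
        simp only [mul_assoc]
      rw [List.map_cons, List.prod_cons, hy, H.proj_eq, List.map_cons, List.prod_cons,
        mul_smul_comm, mul_assoc (e j), ← mul_assoc _ (l.map e).prod, e', smul_mul_assoc,
        mul_smul_comm]
      simp only [mul_assoc]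
    · intro i hi
      suffices h : p i * (p j * z j * r j * y) = 0 ∧ r i * (p j * z j * r j * y) = 0 by
        rw [mul_smul_comm, mul_smul_comm, h.1, h.2, smul_zero]
        exact ⟨rfl, rfl⟩
      by_cases hij : i = j
      · subst hij
        constructor
        · rw [← mul_assoc, ← mul_assoc, ← mul_assoc, H.p_sq, zero_mul, zero_mul, zero_mul]
        · rw [← mul_assoc, ← mul_assoc, ← mul_assoc, H.rp, neg_mul, mul_assoc (p i), H.rz, mul_neg,
            neg_neg, mul_assoc (p i), mul_assoc (z i), H.r_sq, mul_zero, mul_zero, zero_mul]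
      · have hil := hy' i ((List.mem_cons.1 hi).resolve_left hij)
        constructor
        · have e' : p i * (p j * z j * r j) = -(p j * z j * r j * p i) := by
            rw [← mul_assoc, ← mul_assoc, H.pp, neg_mul, mul_assoc (p j), H.pz, if_neg hij,
              zero_sub, mul_neg, neg_neg, mul_assoc, mul_assoc, H.pr]
            simp only [mul_neg, mul_assoc]
          rw [← mul_assoc, e', neg_mul, mul_assoc, hil.1, mul_zero, neg_zero]
        · have e' : r i * (p j * z j * r j) = -(p j * z j * r j * r i) := by
            rw [← mul_assoc, ← mul_assoc, H.rp, neg_mul, mul_assoc (p j), H.rz, mul_neg, neg_neg,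
              mul_assoc, mul_assoc, H.rr]
            simp only [mul_neg, mul_assoc]
          rw [← mul_assoc, e', neg_mul, mul_assoc, hil.2, mul_zero, neg_zero]

end CAR

/-! Creation and annihilation operators on the exterior algebra. -/

section Exterior

variable {M : Type*} [AddCommGroup M] [Module ℂ M]

/-- Left multiplication by a vector on the exterior algebra. -/
def wedgeOp (v : M) : Module.End ℂ (ExteriorAlgebra ℂ M) :=
  LinearMap.mulLeft ℂ (ExteriorAlgebra.ι ℂ v)

/-- Contraction by a linear form on the exterior algebra. -/
def contrOp (f : Module.Dual ℂ M) : Module.End ℂ (ExteriorAlgebra ℂ M) :=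
  CliffordAlgebra.contractLeft f

lemma wedgeOp_apply (v : M) (x : ExteriorAlgebra ℂ M) :
    wedgeOp v x = ExteriorAlgebra.ι ℂ v * x := rfl

lemma wedgeOp_mul_wedgeOp (v w : M) : wedgeOp v * wedgeOp w = -(wedgeOp w * wedgeOp v) := by
  refine LinearMap.ext fun x => ?_
  have h := ExteriorAlgebra.ι_add_mul_swap (R := ℂ) v w
  simp only [Module.End.mul_apply, wedgeOp_apply, LinearMap.neg_apply, ← mul_assoc]
  rw [eq_neg_of_add_eq_zero_left h, neg_mul]

lemma wedgeOp_sq (v : M) : wedgeOp v * wedgeOp v = 0 := by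
  refine LinearMap.ext fun x => ?_
  rw [Module.End.mul_apply, wedgeOp_apply, wedgeOp_apply, ← mul_assoc,
    ExteriorAlgebra.ι_sq_zero, zero_mul, LinearMap.zero_apply]

lemma contrOp_mul_contrOp (f f' : Module.Dual ℂ M) :
    contrOp f * contrOp f' = -(contrOp f' * contrOp f) :=
  LinearMap.ext fun x => CliffordAlgebra.contractLeft_comm f f' x

lemma contrOp_sq (f : Module.Dual ℂ M) : contrOp f * contrOp f = 0 :=
  LinearMap.ext fun x => CliffordAlgebra.contractLeft_contractLeft f x

lemma contrOp_mul_wedgeOp (f : Module.Dual ℂ M) (v : M) :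
    contrOp f * wedgeOp v = f v • (1 : Module.End ℂ _) - wedgeOp v * contrOp f :=
  LinearMap.ext fun x => CliffordAlgebra.contractLeft_ι_mul f v x

lemma contrOp_wedgeOp_apply (f : Module.Dual ℂ M) (v : M) (x : ExteriorAlgebra ℂ M) :
    contrOp f (wedgeOp v x) = f v • x - wedgeOp v (contrOp f x) :=
  CliffordAlgebra.contractLeft_ι_mul f v x

/-- The projection of the exterior algebra to its part of degree `n`. -/
def projDegree (n : ℕ) : ExteriorAlgebra ℂ M →ₗ[ℂ] ⋀[ℂ]^n M :=
  DirectSum.component ℂ ℕ (fun i => ⋀[ℂ]^i M) n ∘ₗ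
    (DirectSum.decomposeLinearEquiv (fun i : ℕ => ⋀[ℂ]^i M)).toLinearMap

lemma projDegree_apply (n : ℕ) (x : ExteriorAlgebra ℂ M) :
    projDegree n x = DirectSum.decompose (fun i : ℕ => ⋀[ℂ]^i M) x n := rfl

lemma projDegree_coe (n : ℕ) (x : ⋀[ℂ]^n M) : projDegree n (x : ExteriorAlgebra ℂ M) = x := by
  rw [projDegree_apply]
  exact Subtype.ext (DirectSum.decompose_of_mem_same (fun i : ℕ => ⋀[ℂ]^i M) x.2)

lemma projDegree_of_ne {m n : ℕ} (h : m ≠ n) {x : ExteriorAlgebra ℂ M} (hx : x ∈ ⋀[ℂ]^m M) :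
    projDegree n x = 0 := by
  rw [projDegree_apply]
  exact Subtype.ext (DirectSum.decompose_of_mem_ne (fun i : ℕ => ⋀[ℂ]^i M) hx h)

lemma ι_mem_exteriorPower (v : M) : ExteriorAlgebra.ι ℂ v ∈ ⋀[ℂ]^1 M := by
  change _ ∈ LinearMap.range (ExteriorAlgebra.ι ℂ) ^ 1
  rw [pow_one]
  exact ⟨v, rfl⟩

lemma coe_projDegree_succ_wedgeOp (n : ℕ) (v : M) (x : ExteriorAlgebra ℂ M) :
    (projDegree (n + 1) (wedgeOp v x) : ExteriorAlgebra ℂ M) = wedgeOp v (projDegree n x) := by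
  have h := DirectSum.coe_decompose_mul_add_of_left_mem (fun i : ℕ => ⋀[ℂ]^i M) (j := n)
    (b := x) (ι_mem_exteriorPower v)
  rw [add_comm] at h
  exact h

lemma projDegree_zero_wedgeOp (v : M) (x : ExteriorAlgebra ℂ M) :
    projDegree 0 (wedgeOp v x) = 0 :=
  Subtype.ext (DirectSum.coe_decompose_mul_of_left_mem_of_not_le (fun i : ℕ => ⋀[ℂ]^i M)
    (b := x) (ι_mem_exteriorPower v) (by simp))

/-- An element of the exterior algebra killed by a family of contractions that is dual to a
spanning family is a scalar. -/
lemma exists_scalar_of_contrOp_eq_zero {κ : Type*} [Fintype κ] (b : κ → M)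
    (f : κ → Module.Dual ℂ M) (hb : ∀ v, ∑ k, f k v • b k = v) {x : ExteriorAlgebra ℂ M}
    (hx : ∀ k, contrOp (f k) x = 0) : ∃ c : ℂ, x = algebraMap ℂ _ c := by
  -- This is the number operator. It satisfies a Leibniz rule for left multiplication by vectors,
  -- hence acts on degree `n` as `n`. Since it kills `x`, every component of `x` of positive degree
  -- vanishes.
  let N : Module.End ℂ (ExteriorAlgebra ℂ M) := ∑ k, wedgeOp (b k) * contrOp (f k)
  have hN : ∀ v y, N (wedgeOp v y) = wedgeOp v y + wedgeOp v (N y) := by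
    intro v y
    simp only [N, LinearMap.sum_apply, Module.End.mul_apply, contrOp_wedgeOp_apply, map_sub,
      Finset.sum_sub_distrib, map_smul, map_sum]
    have h₁ : ∑ k, f k v • wedgeOp (b k) y = wedgeOp v y := by
      conv_rhs => rw [← hb v]
      simp only [wedgeOp_apply, map_sum, map_smul, Finset.sum_mul, smul_mul_assoc]
    have h₂ : ∀ k, wedgeOp (b k) (wedgeOp v (contrOp (f k) y))
        = -wedgeOp v (wedgeOp (b k) (contrOp (f k) y)) := fun k =>
      LinearMap.congr_fun (wedgeOp_mul_wedgeOp (b k) v) _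
    rw [h₁, Finset.sum_congr rfl fun k _ => h₂ k, Finset.sum_neg_distrib, sub_neg_eq_add]
  have hN' : ∀ n, ∀ y ∈ ⋀[ℂ]^n M, N y = (n : ℂ) • y := by
    intro n
    induction n with
    | zero =>
      intro y hy
      change y ∈ LinearMap.range (ExteriorAlgebra.ι ℂ) ^ 0 at hy
      rw [pow_zero, Submodule.mem_one] at hy
      obtain ⟨c, rfl⟩ := hy
      simp only [N, LinearMap.sum_apply, Module.End.mul_apply]
      have : ∀ k, contrOp (f k) (algebraMap ℂ (ExteriorAlgebra ℂ M) c) = 0 := fun k =>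
        CliffordAlgebra.contractLeft_algebraMap _ _ _
      simp [this]
    | succ n ih =>
      intro y hy
      change y ∈ LinearMap.range (ExteriorAlgebra.ι ℂ) ^ (n + 1) at hy
      rw [pow_succ'] at hy
      induction hy using Submodule.mul_induction_on' with
      | mem_mul_mem m hm t ht =>
        obtain ⟨v, rfl⟩ := hm
        have := hN v t
        rw [ih t ht] at this
        simp only [wedgeOp_apply] at this
        rw [this, mul_smul_comm, Nat.cast_succ, add_smul, one_smul, add_comm]
      | add y _ y' _ h h' => rw [map_add, h, h', smul_add]
  have hpr : ∀ n (y : ExteriorAlgebra ℂ M), projDegree n (N y) = (n : ℂ) • projDegree n y := by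
    intro n y
    induction y using DirectSum.Decomposition.inductionOn (fun i : ℕ => ⋀[ℂ]^i M) with
    | zero => simp
    | homogeneous y =>
      rename_i i
      rw [hN' i y y.2, map_smul]
      by_cases h : i = n
      · subst h; rfl
      · rw [projDegree_of_ne h y.2, smul_zero, smul_zero]
    | add y y' h h' => rw [map_add, map_add, h, h', map_add, smul_add]
  have hx0 : N x = 0 := by
    simp only [N, LinearMap.sum_apply, Module.End.mul_apply, hx, map_zero, Finset.sum_const_zero]
  have hpos : ∀ n, n ≠ 0 → projDegree n x = 0 := fun n hn => by
    have := hpr n x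
    rw [hx0, map_zero] at this
    exact (smul_eq_zero.1 this.symm).resolve_left (by exact_mod_cast hn)
  have hmem : x ∈ ⋀[ℂ]^0 M := by
    classical
    have e : x = projDegree 0 x := by
      conv_lhs => rw [← DirectSum.sum_support_decompose (fun i : ℕ => ⋀[ℂ]^i M) x]
      refine Finset.sum_eq_single 0 (fun n _ hn => ?_) (fun h => ?_)
      · rw [← projDegree_apply, hpos n hn]; rfl
      · simpa using h
    rw [e]; exact (projDegree 0 x).2
  change x ∈ LinearMap.range (ExteriorAlgebra.ι ℂ) ^ 0 at hmem
  rw [pow_zero, Submodule.mem_one] at hmem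
  obtain ⟨c, rfl⟩ := hmem
  exact ⟨c, rfl⟩

end Exterior

/-! The covectors `dz̄_j`, `e⁺_j = dz̄_j + i dζ̄_j` and the contractions dual to them. -/

section Covectors

variable {g : ℕ}

/-- The covector `e⁺_j = dz̄_j + i dζ̄_j`. -/
def ePlus (j : Fin g) : Covectors g := dzBar j + Complex.I • dzetaBar j

/-- The linear form dual to `e⁺_j` in the basis `dz̄, e⁺`. -/
def dualPlus (j : Fin g) : Module.Dual ℂ (Covectors g) :=
  -Complex.I • (LinearMap.proj j ∘ₗ LinearMap.snd ℂ (Fin g → ℂ) (Fin g → ℂ))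

/-- The linear form dual to `dz̄_j` in the basis `dz̄, e⁺`. -/
def dualBar (j : Fin g) : Module.Dual ℂ (Covectors g) :=
  LinearMap.proj j ∘ₗ LinearMap.fst ℂ (Fin g → ℂ) (Fin g → ℂ) - dualPlus j

lemma dualPlus_dzBar (i j : Fin g) : dualPlus i (dzBar j) = 0 := by simp [dualPlus, dzBar]

lemma dualPlus_ePlus (i j : Fin g) : dualPlus i (ePlus j) = if i = j then 1 else 0 := by
  simp only [dualPlus, ePlus, dzBar, dzetaBar]
  simp [Pi.single_apply]
  split_ifs <;> simp

lemma dualBar_dzBar (i j : Fin g) : dualBar i (dzBar j) = if i = j then 1 else 0 := by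
  simp [dualBar, dualPlus_dzBar]
  simp [dzBar, Pi.single_apply]

lemma dualBar_ePlus (i j : Fin g) : dualBar i (ePlus j) = 0 := by
  simp [dualBar, dualPlus_ePlus]
  simp [ePlus, dzBar, dzetaBar, Pi.single_apply]

lemma sum_dual_smul (v : Covectors g) :
    ∑ k : Fin g ⊕ Fin g, Sum.elim dualBar dualPlus k v • Sum.elim dzBar ePlus k = v := by
  rw [Fintype.sum_sum_type]
  refine Prod.ext (funext fun i => ?_) (funext fun i => ?_) <;>
  simp [Prod.fst_sum, Prod.snd_sum, dualBar, dualPlus, ePlus, dzBar, dzetaBar,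
    Pi.single_apply, Finset.sum_apply]
  rw [mul_right_comm, Complex.I_mul_I]
  simp

abbrev eZ (j : Fin g) := wedgeOp (dzBar j)
abbrev eP (j : Fin g) := wedgeOp (ePlus j)
abbrev cZ (j : Fin g) := contrOp (dualBar j)
abbrev cP (j : Fin g) := contrOp (dualPlus j)

lemma cZ_eZ (i j : Fin g) : cZ i * eZ j = (if i = j then 1 else 0) - eZ j * cZ i := by
  rw [contrOp_mul_wedgeOp, dualBar_dzBar]; split_ifs <;> simp

lemma cP_eP (i j : Fin g) : cP i * eP j = (if i = j then 1 else 0) - eP j * cP i := by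
  rw [contrOp_mul_wedgeOp, dualPlus_ePlus]; split_ifs <;> simp

lemma cZ_eP (i j : Fin g) : cZ i * eP j = -(eP j * cZ i) := by
  rw [contrOp_mul_wedgeOp, dualBar_ePlus]; simp

lemma cP_eZ (i j : Fin g) : cP i * eZ j = -(eZ j * cP i) := by
  rw [contrOp_mul_wedgeOp, dualPlus_dzBar]; simp

lemma isCAR : CAR (S := Module.End ℂ (ExteriorAlgebra ℂ (Covectors g))) eZ eP cZ cP where
  zz _ _ := wedgeOp_mul_wedgeOp _ _
  ze _ _ := wedgeOp_mul_wedgeOp _ _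
  ee _ _ := wedgeOp_mul_wedgeOp _ _
  pp _ _ := contrOp_mul_contrOp _ _
  rp _ _ := contrOp_mul_contrOp _ _
  pr _ _ := contrOp_mul_contrOp _ _
  rr _ _ := contrOp_mul_contrOp _ _
  pz := cZ_eZ
  re := cP_eP
  pe := cZ_eP
  rz := cP_eZ
  z_sq _ := wedgeOp_sq _
  e_sq _ := wedgeOp_sq _
  p_sq _ := contrOp_sq _
  r_sq _ := contrOp_sq _

/-- The projection to the forms `e⁺_j ∧ y`, where `y` does not involve `dz̄_j` and `e⁺_j`. -/
def plusProj (j : Fin g) : Module.End ℂ (ExteriorAlgebra ℂ (Covectors g)) :=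
  cZ j * eZ j * (eP j * cP j)

/-- The wedge product with `e⁺_{j₁} ∧ ⋯ ∧ e⁺_{jₖ}`, for a list of indices. -/
abbrev plusWedge (l : List (Fin g)) : Module.End ℂ (ExteriorAlgebra ℂ (Covectors g)) :=
  (l.map eP).prod

lemma coe_topPlusForm :
    (topPlusForm g : ExteriorAlgebra ℂ (Covectors g)) = plusWedge (List.finRange g) 1 := by
  have : ∀ l : List (Fin g),
      plusWedge l 1 = (l.map fun j => ExteriorAlgebra.ι ℂ (ePlus j)).prod := by
    intro l
    induction l with
    | nil => rfl
    | cons j l ih => rw [List.map_cons, List.prod_cons, ← ih]; rfl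
  rw [this, ← List.ofFn_eq_map, topPlusForm, exteriorPower.ιMulti_apply_coe,
    ExteriorAlgebra.ιMulti_apply]
  rfl

/-- The product of projections is the wedge with all `e⁺_j` applied to a form killed by every
contraction, and such a form is a scalar. -/
lemma exists_plusProj_eq_smul_top (x : ExteriorAlgebra ℂ (Covectors g)) :
    ∃ c : ℂ, ((List.finRange g).map plusProj).prod x = c • (topPlusForm g).1 := by
  obtain ⟨y, hy, hy'⟩ := isCAR.exists_proj_list (List.finRange g) (List.nodup_finRange g)
  obtain ⟨c, hc⟩ := exists_scalar_of_contrOp_eq_zero (Sum.elim dzBar ePlus)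
    (Sum.elim dualBar dualPlus) sum_dual_smul (x := y x) (by
      rintro (k | k)
      · exact LinearMap.congr_fun (hy' k (List.mem_finRange k)).1 x
      · exact LinearMap.congr_fun (hy' k (List.mem_finRange k)).2 x)
  refine ⟨c, ?_⟩
  refine (LinearMap.congr_fun hy x).trans ?_
  rw [Module.End.mul_apply, hc, coe_topPlusForm, ← map_smul, Algebra.algebraMap_eq_smul_one]

lemma eP_topPlusForm (j : Fin g) : eP j (topPlusForm g).1 = 0 := by
  rw [coe_topPlusForm, ← Module.End.mul_apply, isCAR.e_mul_list_prod (List.mem_finRange j),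
    LinearMap.zero_apply]

lemma cZ_topPlusForm (j : Fin g) : cZ j (topPlusForm g).1 = 0 := by
  obtain ⟨c, hc⟩ := exists_comm_list_prod (x := cZ j) (l := List.finRange g) fun i _ => cZ_eP j i
  rw [coe_topPlusForm, ← Module.End.mul_apply, hc, LinearMap.smul_apply, Module.End.mul_apply]
  have : cZ j (1 : ExteriorAlgebra ℂ (Covectors g)) = 0 :=
    CliffordAlgebra.contractLeft_one _ (dualBar j)
  rw [this, map_zero, smul_zero]

lemma plusProj_topPlusForm (j : Fin g) : plusProj j (topPlusForm g).1 = (topPlusForm g).1 := by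
  have h : eP j * cP j = 1 - cP j * eP j := by rw [cP_eP, if_pos rfl, sub_sub_cancel]
  have h' : cZ j * eZ j = 1 - eZ j * cZ j := by rw [cZ_eZ, if_pos rfl]
  have e : (eP j * cP j) (topPlusForm g).1 = (topPlusForm g).1 := by
    rw [h, LinearMap.sub_apply, Module.End.mul_apply, eP_topPlusForm, map_zero, sub_zero]
    rfl
  rw [plusProj, Module.End.mul_apply, e, h', LinearMap.sub_apply, Module.End.mul_apply,
    cZ_topPlusForm, map_zero, sub_zero]
  rfl

lemma plusProj_list_topPlusForm (l : List (Fin g)) :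
    (l.map plusProj).prod (topPlusForm g).1 = (topPlusForm g).1 := by
  induction l with
  | nil => rfl
  | cons j l ih =>
    rw [List.map_cons, List.prod_cons, Module.End.mul_apply, ih, plusProj_topPlusForm]

/-- Contracting with the dual form of the leading `e⁺_j` removes that factor, so vanishing of the
product would descend to vanishing of `1`. -/
lemma topPlusForm_coe_ne_zero : (topPlusForm g).1 ≠ 0 := by
  have key : ∀ l : List (Fin g), l.Nodup → plusWedge l 1 ≠ 0 := by
    intro l
    induction l with
    | nil => intro _; exact one_ne_zero
    | cons j l ih =>
      intro hl h
      rw [List.nodup_cons] at hl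
      refine ih hl.2 ?_
      obtain ⟨c, hc⟩ := exists_comm_list_prod (x := cP j) (e := eP) (l := l) fun i hi => by
        rw [cP_eP, if_neg (ne_of_mem_of_not_mem hi hl.1).symm, zero_sub]
      have h₁ : cP j (plusWedge l 1) = 0 := by
        rw [← Module.End.mul_apply, hc, LinearMap.smul_apply, Module.End.mul_apply]
        have : cP j (1 : ExteriorAlgebra ℂ (Covectors g)) = 0 :=
          CliffordAlgebra.contractLeft_one _ (dualPlus j)
        rw [this, map_zero, smul_zero]
      have h₂ := congrArg (cP j) h
      rw [plusWedge, List.map_cons, List.prod_cons, ← Module.End.mul_apply, ← mul_assoc, cP_eP,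
        if_pos rfl, map_zero, sub_mul, one_mul, LinearMap.sub_apply, mul_assoc,
        Module.End.mul_apply (eP j),
        Module.End.mul_apply, h₁, map_zero, sub_zero] at h₂
      exact h₂
  rw [coe_topPlusForm]
  exact key _ (List.nodup_finRange g)

end Covectors

end

section

variable {g : ℕ}

/-! Decay of all iterated directional derivatives. -/

/-- Rapid decay in `z - w`, uniformly for `w` in compact sets. -/
def HasDecay (F : V g × V g → ℂ) : Prop :=
  ∀ K : Set (V g), IsCompact K → ∀ k : ℕ, ∃ C : ℝ, ∀ z, ∀ w ∈ K, ‖z - w‖ ^ k * ‖F (z, w)‖ ≤ C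

/-- Rapid decay of the directional derivatives of order at most `m`. -/
def DecayOrder : ℕ → (V g × V g → ℂ) → Prop
  | 0, F => HasDecay F
  | m + 1, F => HasDecay F ∧ Differentiable ℝ F ∧ ∀ v, DecayOrder m (fun p => fderiv ℝ F p v)

lemma HasDecay.add {F G : V g × V g → ℂ} (hF : HasDecay F) (hG : HasDecay G) :
    HasDecay (fun p => F p + G p) := fun K hK k => by
  obtain ⟨C₁, h₁⟩ := hF K hK k
  obtain ⟨C₂, h₂⟩ := hG K hK k
  refine ⟨C₁ + C₂, fun z w hw => ?_⟩
  calc _ ≤ ‖z - w‖ ^ k * (‖F (z, w)‖ + ‖G (z, w)‖) := by gcongr; exact norm_add_le _ _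
    _ ≤ _ := by rw [mul_add]; exact add_le_add (h₁ z w hw) (h₂ z w hw)

lemma HasDecay.clm_mul {F : V g × V g → ℂ} (hF : HasDecay F) (L : V g × V g →L[ℝ] ℂ) :
    HasDecay (fun p => L p * F p) := fun K hK k => by
  obtain ⟨C₁, h₁⟩ := hF K hK (k + 1)
  obtain ⟨C₂, h₂⟩ := hF K hK k
  obtain ⟨R, hR⟩ := hK.isBounded.exists_norm_le
  refine ⟨‖L‖ * (C₁ + |R| * C₂), fun z w hw => ?_⟩
  have h : ‖(z, w)‖ ≤ ‖z - w‖ + |R| := by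
    have hw' := (hR w hw).trans (le_abs_self R)
    refine max_le ?_ (hw'.trans (by linarith [norm_nonneg (z - w)]))
    calc ‖z‖ = ‖(z - w) + w‖ := by simp
      _ ≤ ‖z - w‖ + ‖w‖ := norm_add_le _ _
      _ ≤ _ := by linarith
  have e₁ := h₁ z w hw
  have e₂ := h₂ z w hw
  calc ‖z - w‖ ^ k * ‖L (z, w) * F (z, w)‖
      ≤ ‖z - w‖ ^ k * ((‖L‖ * (‖z - w‖ + |R|)) * ‖F (z, w)‖) := by
        rw [norm_mul]; gcongr; exact (L.le_opNorm _).trans (by gcongr)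
    _ = ‖L‖ * (‖z - w‖ ^ (k + 1) * ‖F (z, w)‖ + |R| * (‖z - w‖ ^ k * ‖F (z, w)‖)) := by ring
    _ ≤ _ := by gcongr

lemma DecayOrder.hasDecay {m : ℕ} {F : V g × V g → ℂ} (h : DecayOrder m F) : HasDecay F := by
  cases m
  · exact h
  · exact h.1

lemma DecayOrder.add {m : ℕ} {F G : V g × V g → ℂ} (hF : DecayOrder m F) (hG : DecayOrder m G) :
    DecayOrder m (fun p => F p + G p) := by
  induction m generalizing F G with
  | zero => exact HasDecay.add hF hG
  | succ m ih =>
    refine ⟨hF.1.add hG.1, hF.2.1.add hG.2.1, fun v => ?_⟩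
    have e : (fun p => fderiv ℝ (fun p => F p + G p) p v)
        = fun p => fderiv ℝ F p v + fderiv ℝ G p v := by
      funext p
      rw [fderiv_fun_add (hF.2.1 p) (hG.2.1 p)]
      rfl
    rw [e]
    exact ih (hF.2.2 v) (hG.2.2 v)

lemma DecayOrder.mono_succ {m : ℕ} {F : V g × V g → ℂ} (hF : DecayOrder (m + 1) F) :
    DecayOrder m F := by
  induction m generalizing F with
  | zero => exact hF.1
  | succ m ih => exact ⟨hF.1, hF.2.1, fun v => ih (hF.2.2 v)⟩

lemma DecayOrder.const_mul {m : ℕ} {F : V g × V g → ℂ} (hF : DecayOrder m F) (c : ℂ) :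
    DecayOrder m (fun p => c * F p) := by
  induction m generalizing F with
  | zero =>
    intro K hK k
    obtain ⟨C, hC⟩ := hF K hK k
    refine ⟨‖c‖ * C, fun z w hw => ?_⟩
    rw [norm_mul, mul_left_comm]
    gcongr
    exact hC z w hw
  | succ m ih =>
    refine ⟨ih (F := F) hF.mono_succ |>.hasDecay, hF.2.1.const_mul c, fun v => ?_⟩
    have e : (fun p => fderiv ℝ (fun p => c * F p) p v) = fun p => c * fderiv ℝ F p v := by
      funext p
      rw [fderiv_const_mul (hF.2.1 p)]
      rfl
    rw [e]
    exact ih (hF.2.2 v)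

lemma DecayOrder.clm_mul {m : ℕ} {F : V g × V g → ℂ} (hF : DecayOrder m F)
    (L : V g × V g →L[ℝ] ℂ) : DecayOrder m (fun p => L p * F p) := by
  induction m generalizing F with
  | zero => exact HasDecay.clm_mul hF L
  | succ m ih =>
    refine ⟨hF.1.clm_mul L, L.differentiable.mul hF.2.1, fun v => ?_⟩
    have e : (fun p => fderiv ℝ (fun p => L p * F p) p v)
        = fun p => L v * F p + L p * fderiv ℝ F p v := by
      funext p
      have h : HasFDerivAt (fun p => L p * F p) _ p := L.hasFDerivAt.mul (hF.2.1 p).hasFDerivAt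
      rw [h.fderiv]
      simp
      ring
    rw [e]
    exact (hF.mono_succ.const_mul (L v)).add (ih (hF.2.2 v))

/-- One order is lost because `DecayOrder 0` says nothing about continuity. -/
lemma DecayOrder.contDiff {m : ℕ} {F : V g × V g → ℂ} (hF : DecayOrder (m + 1) F) :
    ContDiff ℝ m F := by
  induction m generalizing F with
  | zero => exact contDiff_zero.2 hF.2.1.continuous
  | succ m ih =>
    have h := contDiff_succ_iff_fderiv_apply (𝕜 := ℝ) (n := (m : WithTop ℕ∞)) (f := F)
    rw [Nat.cast_succ]
    refine h.2 ⟨hF.2.1, fun h => ?_, fun v => ih (hF.2.2 v)⟩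
    exact absurd h (by exact_mod_cast WithTop.natCast_ne_top m)

/-- A derivative of order `m + 1` is bounded by derivatives of order `m` of the directional
derivatives along a basis. -/
lemma norm_iteratedFDeriv_succ_le_sum {E : Type*} [NormedAddCommGroup E] [NormedSpace ℝ E]
    [FiniteDimensional ℝ E] {ι : Type*} [Fintype ι] (b : Module.Basis ι ℝ E) {F : E → ℂ}
    (hF : ContDiff ℝ ∞ F) (m : ℕ) (x : E) :
    ‖iteratedFDeriv ℝ (m + 1) F x‖ ≤ ∑ i,
      ‖ContinuousLinearMap.smulRightL ℝ E ℂ (LinearMap.toContinuousLinearMap (b.coord i))‖ *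
        ‖iteratedFDeriv ℝ m (fun y => fderiv ℝ F y (b i)) x‖ := by
  have hd : ∀ i, ContDiff ℝ m (fun y => fderiv ℝ F y (b i)) := fun i =>
    ((hF.fderiv_right (m := ∞) (by simp)).clm_apply contDiff_const).of_le
      (by exact_mod_cast le_top)
  have e : fderiv ℝ F = fun y => ∑ i, (ContinuousLinearMap.smulRightL ℝ E ℂ
      (LinearMap.toContinuousLinearMap (b.coord i)) ∘ fun y => fderiv ℝ F y (b i)) y := by
    funext y
    refine ContinuousLinearMap.ext fun v => ?_
    conv_lhs => rw [← b.sum_repr v, map_sum]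
    simp
  rw [← norm_iteratedFDeriv_fderiv, congrArg (iteratedFDeriv ℝ m) e,
    iteratedFDeriv_fun_sum_apply fun i _ =>
      ((ContinuousLinearMap.contDiff _).comp (hd i)).contDiffAt]
  refine (norm_sum_le _ _).trans (Finset.sum_le_sum fun i _ => ?_)
  exact ContinuousLinearMap.norm_iteratedFDeriv_comp_left _ (hd i).contDiffAt le_rfl

/-- Estimates for iterated directional derivatives suffice because the norm of a full derivative is
controlled by those along a finite basis. Directional derivatives are easier to follow through
averages and Gaussian factors. -/
lemma isSchwartzInDifference_of_decayOrder {F : V g × V g → ℂ} (hF : ∀ m, DecayOrder m F) :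
    IsSchwartzInDifference F := by
  have hs : ∀ F : V g × V g → ℂ, (∀ m, DecayOrder m F) → ContDiff ℝ ∞ F := fun F hF =>
    contDiff_infty.2 fun n => (hF (n + 1)).contDiff
  refine ⟨hs F hF, fun K hK k m => ?_⟩
  induction m generalizing F with
  | zero =>
    obtain ⟨C, hC⟩ := hF 0 K hK k
    exact ⟨C, fun z w hw => by rw [norm_iteratedFDeriv_zero]; exact hC z w hw⟩
  | succ m ih =>
    let b := Module.finBasis ℝ (V g × V g)
    choose C hC using fun i => ih (F := fun p => fderiv ℝ F p (b i)) fun m => (hF (m + 1)).2.2 _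
    refine ⟨∑ i, ‖ContinuousLinearMap.smulRightL ℝ (V g × V g) ℂ
      (LinearMap.toContinuousLinearMap (b.coord i))‖ * C i, fun z w hw => ?_⟩
    refine (mul_le_mul_of_nonneg_left (norm_iteratedFDeriv_succ_le_sum b (hs F hF) m (z, w))
      (by positivity)).trans ?_
    rw [Finset.mul_sum]
    refine Finset.sum_le_sum fun i _ => ?_
    rw [mul_left_comm]
    gcongr
    exact hC i z w hw

/-! Scaling and averaging in one coordinate of `z - w`. -/

/-- The part of `(z, w)` along the `j`-th coordinate of `z - w`. -/
def par (j : Fin g) : V g × V g →L[ℝ] V g × V g :=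
  (ContinuousLinearMap.inl ℝ (V g) (V g)).comp
    ((ContinuousLinearMap.single ℝ (fun _ : Fin g => ℂ) j).comp
      ((ContinuousLinearMap.proj j).comp
        (ContinuousLinearMap.fst ℝ (V g) (V g) - ContinuousLinearMap.snd ℝ (V g) (V g))))

lemma par_apply (j : Fin g) (p : V g × V g) : par j p = (Pi.single j (p.1 j - p.2 j), 0) := by
  simp [par, Pi.single_sub]

/-- The scaling of the `j`-th coordinate of `z - w` by `s`, with `w` fixed. -/
def scale (j : Fin g) (s : ℝ) : V g × V g →L[ℝ] V g × V g :=
  ContinuousLinearMap.id ℝ _ + (s - 1) • par j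

lemma scale_apply (j : Fin g) (s : ℝ) (p : V g × V g) : scale j s p = p + (s - 1) • par j p := rfl

lemma scale_snd (j : Fin g) (s : ℝ) (p : V g × V g) : (scale j s p).2 = p.2 := by
  simp [scale_apply, par_apply]

lemma scale_diff (j i : Fin g) (s : ℝ) (p : V g × V g) :
    (scale j s p).1 i - (scale j s p).2 i = (if i = j then (s : ℂ) else 1) * (p.1 i - p.2 i) := by
  rw [scale_snd, scale_apply, par_apply]
  by_cases h : i = j
  · subst h; simp; ring
  · simp [h]

lemma scale_one (j : Fin g) (p : V g × V g) : scale j 1 p = p := by simp [scale_apply]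

lemma scale_translate (j : Fin g) (s : ℝ) (p : V g × V g) (l : V g) :
    scale j s (p + (l, l)) = scale j s p + (l, l) := by
  simp [scale_apply, par_apply]; abel

lemma continuous_scale (j : Fin g) :
    Continuous fun q : ℝ × (V g × V g) => scale j q.1 q.2 := by
  simp only [scale_apply]
  fun_prop

/-- The weighted average `∫₀¹ s^k ψ(z_s, w) ds`, where `z_s` is obtained by scaling the `j`-th
coordinate of `z - w` by `s`. -/
def average (j : Fin g) (k : ℕ) (ψ : V g × V g → ℂ) (p : V g × V g) : ℂ :=
  ∫ s in (0 : ℝ)..1, (s : ℂ) ^ k * ψ (scale j s p)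

lemma intervalIntegrable_average {ψ : V g × V g → ℂ} (h : Continuous ψ) (j : Fin g) (k : ℕ)
    (p : V g × V g) :
    IntervalIntegrable (fun s : ℝ => (s : ℂ) ^ k * ψ (scale j s p)) MeasureTheory.volume 0 1 := by
  refine Continuous.intervalIntegrable ?_ _ _
  have h₁ : Continuous fun s : ℝ => scale j s p := by
    simp only [scale_apply]
    fun_prop
  exact (by fun_prop : Continuous fun s : ℝ => (s : ℂ) ^ k).mul (h.comp h₁)

lemma average_add {ψ χ : V g × V g → ℂ} (h : Continuous ψ) (h' : Continuous χ) (j : Fin g)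
    (k : ℕ) (p : V g × V g) :
    average j k (fun p => ψ p + χ p) p = average j k ψ p + average j k χ p := by
  simp only [average, mul_add]
  exact intervalIntegral.integral_add (intervalIntegrable_average h j k p)
    (intervalIntegrable_average h' j k p)

lemma average_const_mul (c : ℂ) (ψ : V g × V g → ℂ) (j : Fin g) (k : ℕ) (p : V g × V g) :
    average j k (fun p => c * ψ p) p = c * average j k ψ p := by
  simp only [average, mul_left_comm _ c]
  exact intervalIntegral.integral_const_mul _ _

/-- Differentiation under the integral sign; the dominating constant is a bound for the jointly
continuous integrand on the compact product of `[0, 1]` and a closed ball about `p`. -/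
lemma hasFDerivAt_average {ψ : V g × V g → ℂ} (h : ContDiff ℝ ∞ ψ) (j : Fin g) (k : ℕ)
    (p : V g × V g) :
    HasFDerivAt (average j k ψ)
      (∫ s in (0 : ℝ)..1, (s : ℂ) ^ k • (fderiv ℝ ψ (scale j s p)).comp (scale j s)) p ∧
    IntervalIntegrable (fun s : ℝ => (s : ℂ) ^ k • (fderiv ℝ ψ (scale j s p)).comp (scale j s))
      MeasureTheory.volume 0 1 := by
  have hc : Continuous fun q : ℝ × (V g × V g) =>
      ((q.1 : ℝ) : ℂ) ^ k • (fderiv ℝ ψ (scale j q.1 q.2)).comp (scale j q.1) := by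
    have h₁ : Continuous fun q : ℝ × (V g × V g) => fderiv ℝ ψ (scale j q.1 q.2) :=
      (h.continuous_fderiv (by simp)).comp (continuous_scale j)
    have h₂ : Continuous fun q : ℝ × (V g × V g) => scale j q.1 := by
      unfold scale; fun_prop
    exact (by fun_prop : Continuous fun q : ℝ × (V g × V g) => ((q.1 : ℝ) : ℂ) ^ k).smul
      (h₁.clm_comp h₂)
  have hs : ∀ x, Continuous fun s : ℝ => (s, x) := fun x : V g × V g => by fun_prop
  have hψ : ∀ x, Continuous fun s : ℝ => (s : ℂ) ^ k * ψ (scale j s x) := fun x => by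
    have := h.continuous.comp ((continuous_scale j).comp (hs x))
    exact (by fun_prop : Continuous fun s : ℝ => (s : ℂ) ^ k).mul this
  have hi : ∀ x, Continuous fun s : ℝ =>
      (s : ℂ) ^ k • (fderiv ℝ ψ (scale j s x)).comp (scale j s) := fun x => hc.comp (hs x)
  obtain ⟨C, hC⟩ := ((isCompact_Icc (a := (0 : ℝ)) (b := 1)).prod
    (isCompact_closedBall p 1)).exists_bound_of_continuousOn hc.continuousOn
  refine ⟨?_, (hi p).intervalIntegrable _ _⟩
  refine intervalIntegral.hasFDerivAt_integral_of_dominated_of_fderiv_le (bound := fun _ => C)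
    (F' := fun x s => (s : ℂ) ^ k • (fderiv ℝ ψ (scale j s x)).comp (scale j s))
    (Metric.closedBall_mem_nhds p one_pos) (.of_forall fun x => (hψ x).aestronglyMeasurable)
    ((hψ p).intervalIntegrable _ _) (hi p).aestronglyMeasurable
    (.of_forall fun s hs x hx => ?_) intervalIntegrable_const (.of_forall fun s _ x _ => ?_)
  · rw [Set.uIoc_of_le zero_le_one] at hs
    exact hC (s, x) ⟨⟨hs.1.le, hs.2⟩, hx⟩
  · have h₁ : HasFDerivAt (fun x => ψ (scale j s x))
        ((fderiv ℝ ψ (scale j s x)).comp (scale j s)) x :=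
      (h.differentiable (by simp) _).hasFDerivAt.comp x (scale j s).hasFDerivAt
    exact h₁.const_mul _

lemma differentiable_average {ψ : V g × V g → ℂ} (h : ContDiff ℝ ∞ ψ) (j : Fin g) (k : ℕ) :
    Differentiable ℝ (average j k ψ) := fun p => (hasFDerivAt_average h j k p).1.differentiableAt

lemma continuous_fderiv_apply {ψ : V g × V g → ℂ} (h : ContDiff ℝ ∞ ψ) (v : V g × V g) :
    Continuous fun p => fderiv ℝ ψ p v :=
  ((h.fderiv_right (m := ∞) (by simp)).clm_apply contDiff_const).continuous

lemma contDiff_fderiv_apply {ψ : V g × V g → ℂ} (h : ContDiff ℝ ∞ ψ) (v : V g × V g) :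
    ContDiff ℝ ∞ fun p => fderiv ℝ ψ p v :=
  (h.fderiv_right (m := ∞) (by simp)).clm_apply contDiff_const

/-- By the chain rule the scaling acts on the direction `v`: it fixes `v - par j v` and multiplies
`par j v` by `s`, which raises the weight of the second average. -/
lemma fderiv_average {ψ : V g × V g → ℂ} (h : ContDiff ℝ ∞ ψ) (j : Fin g) (k : ℕ)
    (p v : V g × V g) :
    fderiv ℝ (average j k ψ) p v = average j k (fun p => fderiv ℝ ψ p (v - par j v)) p
      + average j (k + 1) (fun p => fderiv ℝ ψ p (par j v)) p := by
  obtain ⟨h₁, h₂⟩ := hasFDerivAt_average h j k p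
  rw [h₁.fderiv, ContinuousLinearMap.intervalIntegral_apply h₂]
  rw [average, average, ← intervalIntegral.integral_add
    (intervalIntegrable_average (continuous_fderiv_apply h _) j k p)
    (intervalIntegrable_average (continuous_fderiv_apply h _) j (k + 1) p)]
  refine intervalIntegral.integral_congr fun s _ => ?_
  have e : scale j s v = (v - par j v) + s • par j v := by
    rw [scale_apply, sub_smul, one_smul]; abel
  simp only [_root_.smul_apply, ContinuousLinearMap.comp_apply, e, map_add, map_smul,
    smul_eq_mul, Complex.real_smul]
  ring

/-- The fundamental theorem of calculus along the scaling of the `j`-th coordinate. -/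
lemma average_fderiv_par {ψ : V g × V g → ℂ} (h : ContDiff ℝ ∞ ψ) (j : Fin g) (k : ℕ)
    (p : V g × V g) :
    (k + 1) * average j k ψ p
      + ∫ s in (0 : ℝ)..1, (s : ℂ) ^ (k + 1) * fderiv ℝ ψ (scale j s p) (par j p) = ψ p := by
  have hd : ∀ s : ℝ, HasDerivAt (fun s : ℝ => (s : ℂ) ^ (k + 1) * ψ (scale j s p))
      ((k + 1) * ((s : ℂ) ^ k * ψ (scale j s p))
        + (s : ℂ) ^ (k + 1) * fderiv ℝ ψ (scale j s p) (par j p)) s := by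
    intro s
    have h₁ : HasDerivAt (fun s : ℝ => scale j s p) (par j p) s := by
      have := (((hasDerivAt_id s).sub_const 1).smul_const (par j p)).const_add p
      simpa [scale_apply] using this
    have h₂ : HasDerivAt (fun s : ℝ => ψ (scale j s p)) (fderiv ℝ ψ (scale j s p) (par j p)) s :=
      (h.differentiable (by simp) _).hasFDerivAt.comp_hasDerivAt s h₁
    have h₃ : HasDerivAt (fun s : ℝ => (s : ℂ) ^ (k + 1)) ((k + 1) * (s : ℂ) ^ k) s := by
      have := (Complex.ofRealCLM.hasDerivAt (x := s)).pow (k + 1)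
      simp only [Nat.add_sub_cancel, Complex.ofRealCLM_apply, Nat.cast_succ, Complex.ofReal_one,
        mul_one] at this
      exact this
    have h₄ := h₃.mul h₂
    rw [mul_assoc] at h₄
    exact h₄
  have hi₁ := (intervalIntegrable_average h.continuous j k p).const_mul ((k : ℂ) + 1)
  have hi₂ := intervalIntegrable_average (continuous_fderiv_apply h (par j p)) j (k + 1) p
  have := intervalIntegral.integral_eq_sub_of_hasDerivAt (fun s _ => hd s) (hi₁.add hi₂)
  rw [intervalIntegral.integral_add hi₁ hi₂, intervalIntegral.integral_const_mul] at this
  rw [average, this]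
  simp [scale_one]

/-- Without a positive power of `s` the boundary term at `s = 0` survives; it is the value on the
hyperplane `z_j = w_j`. The factor `s ^ 0` keeps the integrand in the shape of `average`. -/
lemma integral_fderiv_par {ψ : V g × V g → ℂ} (h : ContDiff ℝ ∞ ψ) (j : Fin g) (p : V g × V g) :
    ∫ s in (0 : ℝ)..1, (s : ℂ) ^ 0 * fderiv ℝ ψ (scale j s p) (par j p)
      = ψ p - ψ (scale j 0 p) := by
  have hd : ∀ s : ℝ, HasDerivAt (fun s : ℝ => ψ (scale j s p))
      ((s : ℂ) ^ 0 * fderiv ℝ ψ (scale j s p) (par j p)) s := by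
    intro s
    have h₁ : HasDerivAt (fun s : ℝ => scale j s p) (par j p) s := by
      have := (((hasDerivAt_id s).sub_const 1).smul_const (par j p)).const_add p
      simpa [scale_apply] using this
    rw [pow_zero, one_mul]
    exact (h.differentiable (by simp) _).hasFDerivAt.comp_hasDerivAt s h₁
  have := intervalIntegral.integral_eq_sub_of_hasDerivAt (fun s _ => hd s)
    (intervalIntegrable_average (continuous_fderiv_apply h (par j p)) j 0 p)
  rw [this, scale_one]

end

section

variable {g : ℕ}

/-! The Gaussian `σ(z, w) exp (-2π |z - w|²)`. -/

/-- The real bilinear form whose diagonal is the logarithm of the Gaussian. -/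
def gaussForm (B : LinearMap.BilinForm ℝ (V g)) : V g × V g →L[ℝ] V g × V g →L[ℝ] ℂ :=
  LinearMap.toContinuousBilinearMap (LinearMap.mk₂ ℝ
    (fun p q => 2 * Real.pi * Complex.I * (B p.1 q.2 : ℂ)
      - 2 * Real.pi * ∑ i, (p.1 i - p.2 i) * starRingEnd ℂ (q.1 i - q.2 i))
    (fun p p' q => by
      have : ∀ i, ((p + p').1 i - (p + p').2 i) = (p.1 i - p.2 i) + (p'.1 i - p'.2 i) := fun i => by
        simp only [Prod.fst_add, Prod.snd_add, Pi.add_apply]; ring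
      simp only [this, add_mul, Finset.sum_add_distrib]
      simp only [Prod.fst_add, map_add, LinearMap.add_apply, Complex.ofReal_add]
      ring)
    (fun c p q => by
      have : ∀ i, ((c • p).1 i - (c • p).2 i) = (c : ℂ) * (p.1 i - p.2 i) := fun i => by
        simp only [Prod.smul_fst, Prod.smul_snd, Pi.smul_apply, Complex.real_smul]; ring
      simp only [this, mul_assoc, ← Finset.mul_sum]
      simp only [Prod.smul_fst, map_smul, LinearMap.smul_apply, smul_eq_mul, Complex.ofReal_mul,
        Complex.real_smul]
      ring)
    (fun p q q' => by
      have : ∀ i, ((q + q').1 i - (q + q').2 i) = (q.1 i - q.2 i) + (q'.1 i - q'.2 i) := fun i => by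
        simp only [Prod.fst_add, Prod.snd_add, Pi.add_apply]; ring
      simp only [this, map_add, mul_add, Finset.sum_add_distrib]
      simp only [Prod.snd_add, map_add, Complex.ofReal_add]
      ring)
    (fun c p q => by
      have : ∀ i, ((c • q).1 i - (c • q).2 i) = (c : ℂ) * (q.1 i - q.2 i) := fun i => by
        simp only [Prod.smul_fst, Prod.smul_snd, Pi.smul_apply, Complex.real_smul]; ring
      simp only [this, map_mul, Complex.conj_ofReal, mul_left_comm _ (c : ℂ), ← Finset.mul_sum]
      simp only [Prod.smul_snd, map_smul, smul_eq_mul, Complex.ofReal_mul, Complex.real_smul]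
      ring))

variable (B : LinearMap.BilinForm ℝ (V g))

lemma gaussForm_apply (p q : V g × V g) : gaussForm B p q
    = 2 * Real.pi * Complex.I * (B p.1 q.2 : ℂ)
      - 2 * Real.pi * ∑ i, (p.1 i - p.2 i) * starRingEnd ℂ (q.1 i - q.2 i) := rfl

/-- The Gaussian `σ(z, w) exp (-2π |z - w|²)`. -/
def gauss (p : V g × V g) : ℂ := Complex.exp (gaussForm B p p)

lemma gaussForm_self (p : V g × V g) : gaussForm B p p = 2 * Real.pi * Complex.I * (B p.1 p.2 : ℂ)
    + ((-2 * Real.pi * ∑ i, ‖p.1 i - p.2 i‖ ^ 2 : ℝ) : ℂ) := by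
  rw [gaussForm_apply]
  simp only [Complex.mul_conj, Complex.normSq_eq_norm_sq]
  push_cast
  ring

lemma gauss_eq (z w : V g) : gauss B (z, w)
    = sigma B z w * Complex.exp (((-2 * Real.pi * ∑ j, ‖z j - w j‖ ^ 2 : ℝ) : ℂ)) := by
  rw [gauss, gaussForm_self, Complex.exp_add]
  rfl

lemma gauss_ne_zero (p : V g × V g) : gauss B p ≠ 0 := Complex.exp_ne_zero _

/-- The logarithmic derivative of the Gaussian in the direction `v`. -/
def gaussLogDeriv (v : V g × V g) : V g × V g →L[ℝ] ℂ := gaussForm B v + (gaussForm B).flip v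

lemma gaussLogDeriv_apply (v p : V g × V g) :
    gaussLogDeriv B v p = gaussForm B v p + gaussForm B p v := rfl

lemma hasFDerivAt_gaussForm_self (p : V g × V g) :
    HasFDerivAt (fun p => gaussForm B p p) ((gaussForm B).flip p + gaussForm B p) p := by
  have h := (gaussForm B).hasFDerivAt.clm_apply (hasFDerivAt_id p)
  refine h.congr_fderiv (ContinuousLinearMap.ext fun v => ?_)
  simp [add_comm]

lemma hasFDerivAt_gauss (p : V g × V g) :
    HasFDerivAt (gauss B) (gauss B p • ((gaussForm B).flip p + gaussForm B p)) p :=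
  (hasFDerivAt_gaussForm_self B p).cexp

lemma contDiff_gaussForm_self : ContDiff ℝ ∞ (fun p => gaussForm B p p) :=
  (gaussForm B).contDiff.clm_apply contDiff_id

/-- The quotient of a function by the Gaussian. -/
def reduced (φ : V g × V g → ℂ) (p : V g × V g) : ℂ := φ p * Complex.exp (-gaussForm B p p)

lemma gauss_mul_reduced (φ : V g × V g → ℂ) (p : V g × V g) : gauss B p * reduced B φ p = φ p := by
  rw [gauss, reduced, mul_left_comm, ← Complex.exp_add, add_neg_cancel, Complex.exp_zero, mul_one]

lemma reduced_gauss_mul (ψ : V g × V g → ℂ) : reduced B (fun p => gauss B p * ψ p) = ψ := by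
  funext p
  rw [reduced, gauss, mul_right_comm, ← Complex.exp_add, add_neg_cancel, Complex.exp_zero, one_mul]

lemma reduced_eq_of_eq {φ ψ : V g × V g → ℂ} (h : ∀ p, φ p = gauss B p * ψ p) :
    reduced B φ = ψ := by
  rw [show φ = _ from funext h, reduced_gauss_mul]

lemma contDiff_reduced {φ : V g × V g → ℂ} (hφ : ContDiff ℝ ∞ φ) : ContDiff ℝ ∞ (reduced B φ) :=
  hφ.mul (contDiff_gaussForm_self B).neg.cexp

lemma fderiv_gauss_mul {ψ : V g × V g → ℂ} {p : V g × V g} (hψ : DifferentiableAt ℝ ψ p)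
    (v : V g × V g) : fderiv ℝ (fun p => gauss B p * ψ p) p v
      = gaussLogDeriv B v p * (gauss B p * ψ p) + gauss B p * fderiv ℝ ψ p v := by
  have h : HasFDerivAt (fun p => gauss B p * ψ p) _ p := (hasFDerivAt_gauss B p).mul hψ.hasFDerivAt
  rw [h.fderiv]
  simp [gaussLogDeriv_apply]
  ring

lemma gauss_mul_fderiv_reduced {φ : V g × V g → ℂ} (hφ : ContDiff ℝ ∞ φ) (p v : V g × V g) :
    gauss B p * fderiv ℝ (reduced B φ) p v = fderiv ℝ φ p v - gaussLogDeriv B v p * φ p := by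
  have h := fderiv_gauss_mul B ((contDiff_reduced B hφ).differentiable (by simp) p) v
  simp only [gauss_mul_reduced] at h
  rw [show (fun p => φ p) = φ from rfl] at h
  rw [h]; ring

/-- The logarithmic derivative of the Gaussian is linear, so differentiating `φ / a` and multiplying
back by `a` gives a derivative of `φ` minus a linear function times `φ`. No Gaussian growth remains.
-/
lemma IsSchwartzInDifference.gauss_mul_fderiv_reduced {φ : V g × V g → ℂ}
    (hφ : IsSchwartzInDifference φ) (v : V g × V g) :
    IsSchwartzInDifference (fun p => gauss B p * fderiv ℝ (reduced B φ) p v) := by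
  have e : (fun p => gauss B p * fderiv ℝ (reduced B φ) p v)
      = (fun p => fderiv ℝ φ p v) + (fun p => (-gaussLogDeriv B v) p) * φ := by
    funext p
    rw [MukaiTorus.gauss_mul_fderiv_reduced B hφ.smooth, Pi.add_apply, Pi.mul_apply, neg_apply]
    ring
  rw [e]
  exact (hφ.fderiv_apply v).add (.mul (.of_clm _) hφ)

/-! Decay estimates. -/

/-- This is applied with `t = |z_j - w_j|` and `x` the size of the difference after scaling by `s`:
powers of `t` are paid for by the Gaussian ratio when `s ≤ 1/2`, and by powers of `x` when `s ≥
1/2`. The bound is uniform in `s`. -/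
lemma pow_mul_exp_le (k : ℕ) {s t x : ℝ} (hs : 0 ≤ s) (hs' : s ≤ 1) (ht : 0 ≤ t) (hx : s * t ≤ x) :
    (1 + t) ^ k * Real.exp (-2 * Real.pi * ((1 - s ^ 2) * t ^ 2))
      ≤ (2 ^ k + k.factorial * Real.exp 2) * (1 + x) ^ k := by
  have hst : 0 ≤ s * t := mul_nonneg hs ht
  have hx0 : 0 ≤ x := hst.trans hx
  rcases le_total (1 / 2) s with h | h
  · have h₁ : Real.exp (-2 * Real.pi * ((1 - s ^ 2) * t ^ 2)) ≤ 1 := by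
      rw [Real.exp_le_one_iff]
      have : 0 ≤ (1 - s ^ 2) * t ^ 2 := mul_nonneg (by nlinarith) (sq_nonneg _)
      nlinarith [Real.pi_pos]
    -- From `s ≥ 1/2` one has `t ≤ 2 s t ≤ 2 x`.
    have h₂ : 1 + t ≤ 2 * (1 + x) := by nlinarith
    calc _ ≤ (2 * (1 + x)) ^ k * 1 := by gcongr
      _ = 2 ^ k * (1 + x) ^ k := by rw [mul_one, mul_pow]
      _ ≤ _ := by gcongr; exact le_add_of_nonneg_right (by positivity)
  · have h₁ : (1 + t) ^ k ≤ k.factorial * Real.exp (1 + t) := by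
      have := Real.pow_div_factorial_le_exp (1 + t) (by linarith) k
      rwa [div_le_iff₀ (by positivity), mul_comm] at this
    -- For `s ≤ 1/2` the coefficient `1 - s²` is at least `3/4`, so with `π > 3` the quadratic term
    -- dominates and the exponent stays below `2`.
    have h₂ : 1 + t + -2 * Real.pi * ((1 - s ^ 2) * t ^ 2) ≤ 2 := by
      have e₁ : 3 / 4 * t ^ 2 ≤ (1 - s ^ 2) * t ^ 2 := by gcongr; nlinarith
      have e₂ := Real.pi_gt_three
      nlinarith [sq_nonneg t, sq_nonneg (t - 1 / 2)]
    calc _ ≤ k.factorial * Real.exp (1 + t) * Real.exp (-2 * Real.pi * ((1 - s ^ 2) * t ^ 2)) := by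
          gcongr
      _ = k.factorial * Real.exp (1 + t + -2 * Real.pi * ((1 - s ^ 2) * t ^ 2)) := by
          rw [mul_assoc, ← Real.exp_add]
      _ ≤ k.factorial * Real.exp 2 := by gcongr
      _ ≤ 2 ^ k + k.factorial * Real.exp 2 := by linarith [pow_pos (two_pos (α := ℝ)) k]
      _ ≤ _ := le_mul_of_one_le_right (by positivity) (one_le_pow₀ (by linarith))

lemma re_gaussForm_self (p : V g × V g) :
    (gaussForm B p p).re = -2 * Real.pi * ∑ i, ‖p.1 i - p.2 i‖ ^ 2 := by
  rw [gaussForm_self, Complex.add_re, Complex.ofReal_re]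
  simp

/-- The factor `σ` has absolute value one, and scaling changes only the `j`-th summand of `|z -
w|²`. For `0 ≤ s ≤ 1` the ratio is at most one, which is why scaling must go inward. -/
lemma norm_gauss_mul_exp_scale (j : Fin g) (s : ℝ) (p : V g × V g) :
    ‖gauss B p * Complex.exp (-gaussForm B (scale j s p) (scale j s p))‖
      = Real.exp (-2 * Real.pi * ((1 - s ^ 2) * ‖p.1 j - p.2 j‖ ^ 2)) := by
  rw [gauss, ← Complex.exp_add, Complex.norm_exp, Complex.add_re, Complex.neg_re,
    re_gaussForm_self, re_gaussForm_self]
  congr 1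
  have : ∑ i, ‖p.1 i - p.2 i‖ ^ 2 - ∑ i, ‖(scale j s p).1 i - (scale j s p).2 i‖ ^ 2
      = (1 - s ^ 2) * ‖p.1 j - p.2 j‖ ^ 2 := by
    rw [← Finset.sum_sub_distrib, Finset.sum_eq_single j]
    · rw [scale_diff, if_pos rfl, norm_mul, mul_pow, Complex.norm_real, Real.norm_eq_abs, sq_abs]
      ring
    · intro i _ hi
      rw [scale_diff, if_neg hi, one_mul, sub_self]
    · simp
  linear_combination -2 * Real.pi * this

lemma hasDecay_average {φ : V g × V g → ℂ} (hφ : IsSchwartzInDifference φ) (j : Fin g) (k : ℕ) :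
    HasDecay (fun p => gauss B p * average j k (reduced B φ) p) := by
  intro K hK n
  -- One factor of order `n` comes from splitting `1 + ‖z - w‖` into the scaled coordinate and the
  -- scaled point, the other from `pow_mul_exp_le`. The same compact set works because scaling fixes
  -- `w`.
  obtain ⟨C, hC⟩ := hφ.decay_one_add hK (2 * n) 0
  set M : ℝ := 2 ^ n + n.factorial * Real.exp 2 with hM
  refine ⟨M * C, fun z w hw => ?_⟩
  have e : ((‖z - w‖ : ℝ) : ℂ) ^ n * (gauss B (z, w) * average j k (reduced B φ) (z, w))
      = ∫ s in (0 : ℝ)..1, ((‖z - w‖ : ℝ) : ℂ) ^ n * (gauss B (z, w) *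
          ((s : ℂ) ^ k * reduced B φ (scale j s (z, w)))) := by
    rw [intervalIntegral.integral_const_mul, intervalIntegral.integral_const_mul, average]
  have e' : ‖z - w‖ ^ n * ‖gauss B (z, w) * average j k (reduced B φ) (z, w)‖
      = ‖((‖z - w‖ : ℝ) : ℂ) ^ n * (gauss B (z, w) * average j k (reduced B φ) (z, w))‖ := by
    rw [norm_mul (_ ^ n), norm_pow, Complex.norm_real, norm_norm]
  rw [e', e]
  refine (intervalIntegral.norm_integral_le_of_norm_le_const (C := M * C) fun s hs => ?_).trans
    (by simp)
  rw [Set.uIoc_of_le zero_le_one] at hs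
  set q := scale j s (z, w) with hq
  set t := ‖z j - w j‖ with ht
  have hq2 : q.2 = w := scale_snd j s (z, w)
  have h₁ : s * t ≤ ‖q.1 - q.2‖ := by
    have := norm_le_pi_norm (q.1 - q.2) j
    rw [Pi.sub_apply, hq, scale_diff, if_pos rfl, norm_mul, Complex.norm_real, Real.norm_eq_abs,
      abs_of_pos hs.1] at this
    exact this
  have h₂ : 1 + ‖z - w‖ ≤ (1 + t) * (1 + ‖q.1 - q.2‖) := by
    have : ‖z - w‖ ≤ t + ‖q.1 - q.2‖ := by
      refine (pi_norm_le_iff_of_nonneg (by positivity)).2 fun i => ?_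
      by_cases hi : i = j
      · subst hi
        exact le_add_of_nonneg_right (norm_nonneg _)
      · have := norm_le_pi_norm (q.1 - q.2) i
        rw [Pi.sub_apply, hq, scale_diff, if_neg hi, one_mul] at this
        exact this.trans (le_add_of_nonneg_left (norm_nonneg _))
    nlinarith [mul_nonneg (norm_nonneg (z j - w j)) (norm_nonneg (q.1 - q.2))]
  have h₃ := pow_mul_exp_le n hs.1.le hs.2 (norm_nonneg (z j - w j)) h₁
  have h₄ := hC q.1 w hw
  rw [norm_iteratedFDeriv_zero, ← hq2] at h₄
  have h₅ : ‖(s : ℂ) ^ k‖ ≤ 1 := by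
    rw [norm_pow, Complex.norm_real, Real.norm_eq_abs, abs_of_pos hs.1]
    exact pow_le_one₀ hs.1.le hs.2
  calc _ = ‖z - w‖ ^ n * (‖(s : ℂ) ^ k‖ * (‖gauss B (z, w) * Complex.exp (-gaussForm B q q)‖
        * ‖φ q‖)) := by
        simp only [reduced, norm_mul, norm_pow, Complex.norm_real, norm_norm]
        ring
    _ ≤ ((1 + t) * (1 + ‖q.1 - q.2‖)) ^ n
          * (1 * (Real.exp (-2 * Real.pi * ((1 - s ^ 2) * t ^ 2)) * ‖φ q‖)) := by
        rw [norm_gauss_mul_exp_scale]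
        gcongr
        linarith
    _ = (1 + t) ^ n * Real.exp (-2 * Real.pi * ((1 - s ^ 2) * t ^ 2))
          * ((1 + ‖q.1 - q.2‖) ^ n * ‖φ q‖) := by rw [mul_pow]; ring
    _ ≤ M * (1 + ‖q.1 - q.2‖) ^ n * ((1 + ‖q.1 - q.2‖) ^ n * ‖φ q‖) := by gcongr
    _ = M * ((1 + ‖q.1 - q.2‖) ^ (2 * n) * ‖φ (q.1, q.2)‖) := by ring
    _ ≤ M * C := by gcongr

/-- The family of functions `a · A_k(φ / a)` is closed under differentiation up to multiplication by
linear functions: a derivative yields a linear multiple of the same function and two members in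
which `φ` is replaced by `a` times a derivative of `φ / a`, again Schwartz. Hence the induction
varies `φ` and `k`. -/
lemma decayOrder_average {φ : V g × V g → ℂ} (hφ : IsSchwartzInDifference φ) (j : Fin g) (k m : ℕ) :
    DecayOrder m (fun p => gauss B p * average j k (reduced B φ) p) := by
  induction m generalizing φ k with
  | zero => exact hasDecay_average B hφ j k
  | succ m ih =>
    have hr := contDiff_reduced B hφ.smooth
    have hd := differentiable_average hr j k
    refine ⟨hasDecay_average B hφ j k,
      fun p => (hasFDerivAt_gauss B p).differentiableAt.mul (hd p), fun v => ?_⟩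
    have e : (fun p => fderiv ℝ (fun p => gauss B p * average j k (reduced B φ) p) p v)
        = fun p => gaussLogDeriv B v p * (gauss B p * average j k (reduced B φ) p)
          + (gauss B p * average j k (reduced B fun p =>
              gauss B p * fderiv ℝ (reduced B φ) p (v - par j v)) p
            + gauss B p * average j (k + 1) (reduced B fun p =>
              gauss B p * fderiv ℝ (reduced B φ) p (par j v)) p) := by
      funext p
      rw [fderiv_gauss_mul B (hd p), fderiv_average hr, reduced_gauss_mul, reduced_gauss_mul]
      ring
    rw [e]
    exact ((ih hφ k).clm_mul _).add ((ih (hφ.gauss_mul_fderiv_reduced B _) k).add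
      (ih (hφ.gauss_mul_fderiv_reduced B _) (k + 1)))

lemma IsSchwartzInDifference.average {φ : V g × V g → ℂ} (hφ : IsSchwartzInDifference φ)
    (j : Fin g) (k : ℕ) :
    IsSchwartzInDifference (fun p => gauss B p * average j k (reduced B φ) p) :=
  isSchwartzInDifference_of_decayOrder (decayOrder_average B hφ j k)

lemma hasDecay_gauss : HasDecay (gauss B) := by
  intro K _ n
  refine ⟨2 ^ n + n.factorial * Real.exp 2, fun z w _ => ?_⟩
  -- The case `s = 0`, `x = 0` of the estimate is the decay of the pure Gaussian.
  have h := pow_mul_exp_le n le_rfl zero_le_one (norm_nonneg (z - w))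
    (x := 0) (by rw [zero_mul])
  simp only [ne_eq, OfNat.ofNat_ne_zero, not_false_eq_true, zero_pow, sub_zero, one_mul, add_zero,
    one_pow, mul_one] at h
  have h₁ : ‖z - w‖ ^ 2 ≤ ∑ i, ‖z i - w i‖ ^ 2 := by
    rw [← Real.le_sqrt (norm_nonneg _) (by positivity)]
    refine (pi_norm_le_iff_of_nonneg (Real.sqrt_nonneg _)).2 fun i => ?_
    rw [Real.le_sqrt (norm_nonneg _) (by positivity)]
    exact Finset.single_le_sum (f := fun i => ‖z i - w i‖ ^ 2) (fun i _ => by positivity)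
      (Finset.mem_univ i)
  refine le_trans ?_ h
  rw [gauss, Complex.norm_exp, re_gaussForm_self]
  have : -2 * Real.pi * ∑ i, ‖z i - w i‖ ^ 2 ≤ -2 * Real.pi * ‖z - w‖ ^ 2 :=
    mul_le_mul_of_nonpos_left h₁ (by linarith [Real.pi_pos])
  gcongr
  linarith

lemma isSchwartzInDifference_gauss : IsSchwartzInDifference (gauss B) := by
  refine isSchwartzInDifference_of_decayOrder fun m => ?_
  induction m with
  | zero => exact hasDecay_gauss B
  | succ m ih =>
    refine ⟨hasDecay_gauss B, fun p => (hasFDerivAt_gauss B p).differentiableAt, fun v => ?_⟩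
    have e : (fun p => fderiv ℝ (gauss B) p v) = fun p => gaussLogDeriv B v p * gauss B p := by
      funext p
      rw [(hasFDerivAt_gauss B p).fderiv]
      simp [gaussLogDeriv_apply]
      ring
    rw [e]
    exact ih.clm_mul _

/-! Translations. -/

variable {B}

/-- `|z - w|` is unchanged, and the cross terms in `B(z + l, w + l)` cancel against `B(l, z - w)`
since `B` is alternating. Division by the Gaussian therefore turns twisted invariance into plain
invariance under `(l, l)`. -/
lemma gauss_translate (hB : B.IsAlt) (p : V g × V g) (l : V g) :
    gauss B (p + (l, l)) * sigma B l (p.1 - p.2) = gauss B p := by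
  rw [gauss, gauss, sigma, ← Complex.exp_add, gaussForm_self, gaussForm_self]
  congr 1
  have h : ∀ i, (p + (l, l)).1 i - (p + (l, l)).2 i = p.1 i - p.2 i := fun i => by simp
  simp only [h]
  have e : B (p + (l, l)).1 (p + (l, l)).2 + B l (p.1 - p.2) = B p.1 p.2 := by
    have h₁ : B l l = 0 := hB l
    have h₂ : B p.1 l = -B l p.1 := (LinearMap.IsAlt.neg hB l p.1).symm
    simp only [Prod.fst_add, Prod.snd_add, map_add, LinearMap.add_apply, map_sub, h₁, h₂]
    ring
  rw [← e]
  push_cast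
  ring

lemma IsInvariant.reduced {Λ : Submodule ℤ (V g)} (hB : B.IsAlt) {φ : V g × V g → ℂ}
    (hφ : IsInvariant Λ B φ) {l : V g} (hl : l ∈ Λ) (p : V g × V g) :
    reduced B φ (p + (l, l)) = reduced B φ p := by
  have h := hφ l hl p.1 p.2
  rw [show (p.1 + l, p.2 + l) = p + (l, l) from rfl, show (p.1, p.2) = p from rfl,
    ← gauss_mul_reduced B φ, ← gauss_mul_reduced B φ, mul_right_comm, gauss_translate hB] at h
  exact mul_left_cancel₀ (gauss_ne_zero B p) h

lemma isInvariant_gauss_mul {Λ : Submodule ℤ (V g)} (hB : B.IsAlt) {ψ : V g × V g → ℂ}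
    (hψ : ∀ l ∈ Λ, ∀ p, ψ (p + (l, l)) = ψ p) :
    IsInvariant Λ B (fun p => gauss B p * ψ p) := fun l hl z w => by
  have h := gauss_translate hB (z, w) l
  have h' := hψ l hl (z, w)
  simp only [Prod.mk_add_mk] at h h'
  beta_reduce
  rw [h', mul_right_comm, h]

end

section

variable {g : ℕ}

/-! Complex derivatives, and how they interact with multiplications and averages. -/

/-- The operator `(∂/∂x_j + c ∂/∂y_j) / 2` in the first variable. -/
def wirtinger (c : ℂ) (j : Fin g) (ψ : V g × V g → ℂ) (p : V g × V g) : ℂ :=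
  (fderiv ℝ ψ p (Pi.single j 1, 0) + c * fderiv ℝ ψ p (Pi.single j Complex.I, 0)) / 2

lemma contDiff_wirtinger {ψ : V g × V g → ℂ} (h : ContDiff ℝ ∞ ψ) (c : ℂ) (j : Fin g) :
    ContDiff ℝ ∞ (wirtinger c j ψ) :=
  ((contDiff_fderiv_apply h _).add (contDiff_const.mul (contDiff_fderiv_apply h _))).div_const 2

lemma fderiv_wirtinger {ψ : V g × V g → ℂ} (h : ContDiff ℝ ∞ ψ) (c : ℂ) (j : Fin g)
    (p v : V g × V g) : fderiv ℝ (wirtinger c j ψ) p v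
      = (fderiv ℝ (fun p => fderiv ℝ ψ p (Pi.single j 1, 0)) p v
          + c * fderiv ℝ (fun p => fderiv ℝ ψ p (Pi.single j Complex.I, 0)) p v) / 2 := by
  have h₁ : ∀ u, HasFDerivAt (fun p => fderiv ℝ ψ p u)
      (fderiv ℝ (fun p => fderiv ℝ ψ p u) p) p := fun u =>
    ((contDiff_fderiv_apply h u).differentiable (by simp) p).hasFDerivAt
  have h₂ : HasFDerivAt (wirtinger c j ψ) _ p :=
    ((h₁ (Pi.single j 1, 0)).add ((h₁ (Pi.single j Complex.I, 0)).const_mul c)).mul_const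
      (2⁻¹ : ℂ)
  rw [h₂.fderiv]
  simp
  ring

lemma fderiv_fderiv_comm {ψ : V g × V g → ℂ} (h : ContDiff ℝ ∞ ψ) (p u v : V g × V g) :
    fderiv ℝ (fun p => fderiv ℝ ψ p u) p v = fderiv ℝ (fun p => fderiv ℝ ψ p v) p u := by
  have hd : DifferentiableAt ℝ (fderiv ℝ ψ) p :=
    (h.fderiv_right (m := ∞) (by simp)).differentiable (by simp) p
  have e : ∀ u, fderiv ℝ (fun p => fderiv ℝ ψ p u) p = (fderiv ℝ (fderiv ℝ ψ) p).flip u := fun u =>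
    (hd.hasFDerivAt.clm_apply (hasFDerivAt_const u p)).fderiv.trans
      (ContinuousLinearMap.ext fun v => by simp)
  rw [e, e]
  exact (h.contDiffAt.isSymmSndFDerivAt
    (by simpa using WithTop.coe_le_coe.2 (le_top (a := (2 : ℕ∞))))) v u

lemma wirtinger_comm {ψ : V g × V g → ℂ} (h : ContDiff ℝ ∞ ψ) (c c' : ℂ) (i j : Fin g) :
    wirtinger c i (wirtinger c' j ψ) = wirtinger c' j (wirtinger c i ψ) := by
  funext p
  rw [wirtinger, wirtinger, fderiv_wirtinger h, fderiv_wirtinger h, fderiv_wirtinger h,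
    fderiv_wirtinger h, fderiv_fderiv_comm h p (Pi.single i 1, 0),
    fderiv_fderiv_comm h p (Pi.single i 1, 0), fderiv_fderiv_comm h p (Pi.single i Complex.I, 0),
    fderiv_fderiv_comm h p (Pi.single i Complex.I, 0)]
  ring

lemma wirtinger_clm_mul {ψ : V g × V g → ℂ} (h : ContDiff ℝ ∞ ψ) (L : V g × V g →L[ℝ] ℂ) (c : ℂ)
    (j : Fin g) (p : V g × V g) : wirtinger c j (fun p => L p * ψ p) p
      = (L (Pi.single j 1, 0) + c * L (Pi.single j Complex.I, 0)) / 2 * ψ p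
        + L p * wirtinger c j ψ p := by
  have h₁ : HasFDerivAt (fun p => L p * ψ p) _ p :=
    L.hasFDerivAt.mul (h.differentiable (by simp) p).hasFDerivAt
  rw [wirtinger, h₁.fderiv, wirtinger]
  simp
  ring

/-- The parameter `-i` gives `∂/∂z_j` and `i` gives `∂/∂z̄_j`, so this is the splitting of a real
derivative into its complex linear and antilinear parts. -/
lemma fderiv_single (ψ : V g × V g → ℂ) (p : V g × V g) (j : Fin g) (c : ℂ) :
    fderiv ℝ ψ p (Pi.single j c, 0) = c * wirtinger (-Complex.I) j ψ p
      + starRingEnd ℂ c * wirtinger Complex.I j ψ p := by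
  have e : ((Pi.single j c, 0) : V g × V g)
      = c.re • (Pi.single j 1, 0) + c.im • (Pi.single j Complex.I, 0) := by
    refine Prod.ext (funext fun i => ?_) (by simp)
    by_cases hi : i = j
    · subst hi; simp
    · simp [hi]
  rw [e, map_add, map_smul, map_smul, wirtinger, wirtinger, Complex.real_smul, Complex.real_smul]
  conv_rhs => rw [← Complex.re_add_im c]
  simp only [map_add, map_mul, Complex.conj_ofReal, Complex.conj_I]
  linear_combination ((c.im : ℂ) * fderiv ℝ ψ p (Pi.single j Complex.I, 0)) * Complex.I_sq

lemma par_single_of_ne {i j : Fin g} (h : i ≠ j) (c : ℂ) :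
    par j (Pi.single i c, 0) = 0 := by
  rw [par_apply]
  simp [Pi.single_eq_of_ne h.symm]

lemma par_single_self (j : Fin g) (c : ℂ) :
    par j (Pi.single j c, 0) = (Pi.single j c, 0) := by
  rw [par_apply]
  simp

lemma average_zero (j : Fin g) (k : ℕ) (p : V g × V g) : average j k (fun _ => 0) p = 0 := by
  simp [average]

lemma average_wirtinger {ψ : V g × V g → ℂ} (h : ContDiff ℝ ∞ ψ) (c : ℂ) (i j : Fin g) (k : ℕ)
    (p : V g × V g) : average j k (wirtinger c i ψ) p
      = (average j k (fun p => fderiv ℝ ψ p (Pi.single i 1, 0)) p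
        + c * average j k (fun p => fderiv ℝ ψ p (Pi.single i Complex.I, 0)) p) / 2 := by
  have e : wirtinger c i ψ = fun p => (1 / 2) * (fderiv ℝ ψ p (Pi.single i 1, 0)
      + c * fderiv ℝ ψ p (Pi.single i Complex.I, 0)) := by
    funext p; rw [wirtinger]; ring
  rw [e, average_const_mul, average_add (χ := fun p => c * fderiv ℝ ψ p (Pi.single i Complex.I, 0))
    (continuous_fderiv_apply h _) (continuous_const.mul (continuous_fderiv_apply h _)),
    average_const_mul]
  ring

lemma wirtinger_average_of_ne {ψ : V g × V g → ℂ} (h : ContDiff ℝ ∞ ψ) (c : ℂ) {i j : Fin g}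
    (hij : i ≠ j) (k : ℕ) :
    wirtinger c i (average j k ψ) = average j k (wirtinger c i ψ) := by
  funext p
  rw [average_wirtinger h, wirtinger, fderiv_average h, fderiv_average h, par_single_of_ne hij,
    par_single_of_ne hij]
  simp [average_zero]

/-- Differentiating along the scaled coordinate itself pulls out one factor `s`; other coordinates
do not. -/
lemma wirtinger_average_self {ψ : V g × V g → ℂ} (h : ContDiff ℝ ∞ ψ) (c : ℂ) (j : Fin g) (k : ℕ) :
    wirtinger c j (average j k ψ) = average j (k + 1) (wirtinger c j ψ) := by
  funext p
  rw [average_wirtinger h, wirtinger, fderiv_average h, fderiv_average h, par_single_self,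
    par_single_self]
  simp [average_zero]

/-- The `i`-th coordinate of `z - w`. -/
def coordDiff (i : Fin g) : V g × V g →L[ℝ] ℂ :=
  (ContinuousLinearMap.proj (R := ℝ) (φ := fun _ : Fin g => ℂ) i).comp
    (ContinuousLinearMap.fst ℝ (V g) (V g) - ContinuousLinearMap.snd ℝ (V g) (V g))

/-- The conjugate of the `i`-th coordinate of `z - w`. -/
def conjCoordDiff (i : Fin g) : V g × V g →L[ℝ] ℂ :=
  (Complex.conjCLE : ℂ →L[ℝ] ℂ).comp (coordDiff i)

lemma coordDiff_apply (i : Fin g) (p : V g × V g) : coordDiff i p = p.1 i - p.2 i := rfl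

lemma conjCoordDiff_apply (i : Fin g) (p : V g × V g) :
    conjCoordDiff i p = starRingEnd ℂ (p.1 i - p.2 i) := rfl

lemma average_mul_of_scale_ne {L : V g × V g → ℂ} {j : Fin g}
    (hL : ∀ (s : ℝ) p, L (scale j s p) = L p) (ψ : V g × V g → ℂ) (k : ℕ) :
    average j k (fun p => L p * ψ p) = fun p => L p * average j k ψ p := by
  funext p
  simp only [average, hL, mul_left_comm _ (L p)]
  exact intervalIntegral.integral_const_mul _ _

lemma average_mul_of_scale_self {L : V g × V g → ℂ} {j : Fin g}
    (hL : ∀ (s : ℝ) p, L (scale j s p) = s * L p) (ψ : V g × V g → ℂ) (k : ℕ) :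
    average j k (fun p => L p * ψ p) = fun p => L p * average j (k + 1) ψ p := by
  funext p
  simp only [average, hL]
  rw [← intervalIntegral.integral_const_mul]
  refine intervalIntegral.integral_congr fun s _ => ?_
  ring_nf

/-- The velocity of the scaling path is `z_j - w_j` in the `j`-th direction, constant in `s`;
splitting it into `∂` and `∂̄` parts brings the two coordinates out of the integral. -/
lemma integral_fderiv_par_eq {ψ : V g × V g → ℂ} (h : ContDiff ℝ ∞ ψ) (j : Fin g) (k : ℕ)
    (p : V g × V g) :
    ∫ s in (0 : ℝ)..1, (s : ℂ) ^ k * fderiv ℝ ψ (scale j s p) (par j p)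
      = coordDiff j p * average j k (wirtinger (-Complex.I) j ψ) p
        + conjCoordDiff j p * average j k (wirtinger Complex.I j ψ) p := by
  rw [← average_const_mul, ← average_const_mul, ← average_add
    (ψ := fun q => coordDiff j p * wirtinger (-Complex.I) j ψ q)
    (χ := fun q => conjCoordDiff j p * wirtinger Complex.I j ψ q)
    (continuous_const.mul (contDiff_wirtinger h _ j).continuous)
    (continuous_const.mul (contDiff_wirtinger h _ j).continuous)]
  refine intervalIntegral.integral_congr fun s _ => ?_
  beta_reduce
  rw [par_apply, fderiv_single, coordDiff_apply, conjCoordDiff_apply]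

end

section

variable {g : ℕ} {Λ : Submodule ℤ (V g)} {B : LinearMap.BilinForm ℝ (V g)}

/-! Operators on the space of invariant functions. -/

lemma reduced_add (φ ψ : invariantFunctions Λ B) :
    reduced B (φ + ψ).1 = fun p => reduced B φ.1 p + reduced B ψ.1 p :=
  funext fun _ => add_mul _ _ _

lemma reduced_sub (φ ψ : invariantFunctions Λ B) :
    reduced B (φ - ψ).1 = fun p => reduced B φ.1 p - reduced B ψ.1 p :=
  funext fun _ => sub_mul _ _ _

lemma reduced_smul (f : smoothFunctions Λ) (φ : invariantFunctions Λ B) :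
    reduced B (f • φ).1 = fun p => f.1 p.2 * reduced B φ.1 p :=
  funext fun _ => mul_assoc _ _ _

lemma reduced_const_smul (c : ℂ) (φ : invariantFunctions Λ B) :
    reduced B (c • φ).1 = fun p => c * reduced B φ.1 p :=
  funext fun _ => mul_assoc _ _ _

lemma eq_of_reduced_eq {φ ψ : invariantFunctions Λ B}
    (h : reduced B φ.1 = reduced B ψ.1) : φ = ψ :=
  Subtype.ext (funext fun p => by
    rw [← gauss_mul_reduced B φ.1, h, gauss_mul_reduced])

lemma contDiff_reduced_coe (φ : invariantFunctions Λ B) : ContDiff ℝ ∞ (reduced B φ.1) :=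
  contDiff_reduced B φ.2.1.smooth

/-- The conjugate by the Gaussian of a translation invariant operator, as an operator on the
invariant functions. -/
def conjGauss (hB : B.IsAlt) (T : (V g × V g → ℂ) → (V g × V g → ℂ))
    (hS : ∀ φ : invariantFunctions Λ B,
      IsSchwartzInDifference (fun p => gauss B p * T (reduced B φ.1) p))
    (hT : ∀ (ψ : V g × V g → ℂ) (l : V g) p,
      T (fun p => ψ (p + (l, l))) p = T ψ (p + (l, l)))
    (hadd : ∀ ψ ψ' : V g × V g → ℂ, ContDiff ℝ ∞ ψ → ContDiff ℝ ∞ ψ' →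
      T (fun p => ψ p + ψ' p) = fun p => T ψ p + T ψ' p)
    (hsmul : ∀ (f : V g → ℂ) (ψ : V g × V g → ℂ), ContDiff ℝ ∞ f → ContDiff ℝ ∞ ψ →
      T (fun p => f p.2 * ψ p) = fun p => f p.2 * T ψ p) :
    Module.End (smoothFunctions Λ) (invariantFunctions Λ B) where
  toFun φ := ⟨fun p => gauss B p * T (reduced B φ.1) p, hS φ, isInvariant_gauss_mul hB
    fun l hl p => by
      rw [← hT]
      exact congrFun (congrArg T (funext fun q => φ.2.2.reduced hB hl q)) p⟩
  map_add' φ ψ := eq_of_reduced_eq (by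
    refine (reduced_gauss_mul B _).trans ?_
    rw [reduced_add, reduced_add, hadd _ _ (contDiff_reduced_coe φ) (contDiff_reduced_coe ψ)]
    simp only [reduced_gauss_mul])
  map_smul' f φ := eq_of_reduced_eq (by
    refine (reduced_gauss_mul B _).trans ?_
    rw [RingHom.id_apply, reduced_smul, reduced_smul, hsmul _ _ f.2.1 (contDiff_reduced_coe φ)]
    simp only [reduced_gauss_mul])

lemma fderiv_comp_translate (ψ : V g × V g → ℂ) (a p : V g × V g) :
    fderiv ℝ (fun p => ψ (p + a)) p = fderiv ℝ ψ (p + a) := fderiv_comp_add_right a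

lemma wirtinger_translate (ψ : V g × V g → ℂ) (c : ℂ) (j : Fin g) (a p : V g × V g) :
    wirtinger c j (fun p => ψ (p + a)) p = wirtinger c j ψ (p + a) := by
  simp only [wirtinger, fderiv_comp_translate]

lemma wirtinger_add {ψ χ : V g × V g → ℂ} (hψ : ContDiff ℝ ∞ ψ) (hχ : ContDiff ℝ ∞ χ) (c : ℂ)
    (j : Fin g) :
    wirtinger c j (fun p => ψ p + χ p) = fun p => wirtinger c j ψ p + wirtinger c j χ p := by
  funext p
  simp only [wirtinger]
  rw [fderiv_fun_add (hψ.differentiable (by simp) p) (hχ.differentiable (by simp) p)]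
  simp only [add_apply]
  ring

lemma wirtinger_snd_mul {f : V g → ℂ} {ψ : V g × V g → ℂ} (hf : ContDiff ℝ ∞ f)
    (hψ : ContDiff ℝ ∞ ψ) (c : ℂ) (j : Fin g) :
    wirtinger c j (fun p => f p.2 * ψ p) = fun p => f p.2 * wirtinger c j ψ p := by
  funext p
  have h₁ : HasFDerivAt (fun p : V g × V g => f p.2)
      ((fderiv ℝ f p.2).comp (ContinuousLinearMap.snd ℝ (V g) (V g))) p :=
    HasFDerivAt.comp p (hf.differentiable (by simp) p.2).hasFDerivAt hasFDerivAt_snd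
  have h₂ : HasFDerivAt (fun p => f p.2 * ψ p) _ p :=
    h₁.mul (hψ.differentiable (by simp) p).hasFDerivAt
  simp only [wirtinger, h₂.fderiv]
  simp
  ring

lemma IsSchwartzInDifference.gauss_mul_wirtinger {φ : V g × V g → ℂ}
    (hφ : IsSchwartzInDifference φ) (c : ℂ) (j : Fin g) :
    IsSchwartzInDifference (fun p => gauss B p * wirtinger c j (reduced B φ) p) := by
  have e : (fun p => gauss B p * wirtinger c j (reduced B φ) p) = (fun _ => (1 / 2 : ℂ)) *
      ((fun p => gauss B p * fderiv ℝ (reduced B φ) p (Pi.single j 1, 0)) + (fun _ => c) *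
        (fun p => gauss B p * fderiv ℝ (reduced B φ) p (Pi.single j Complex.I, 0))) := by
    funext p
    simp only [wirtinger, Pi.mul_apply, Pi.add_apply]
    ring
  rw [e]
  exact .mul (.const _) ((hφ.gauss_mul_fderiv_reduced B _).add
    (.mul (.const _) (hφ.gauss_mul_fderiv_reduced B _)))

/-- The conjugate by the Gaussian of `∂/∂z_j`. -/
def delOp (Λ : Submodule ℤ (V g)) (hB : B.IsAlt) (j : Fin g) :
    Module.End (smoothFunctions Λ) (invariantFunctions Λ B) :=
  conjGauss hB (wirtinger (-Complex.I) j) (fun φ => φ.2.1.gauss_mul_wirtinger _ j)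
    (fun _ _ _ => wirtinger_translate _ _ _ _ _) (fun _ _ h h' => wirtinger_add h h' _ j)
    (fun _ _ h h' => wirtinger_snd_mul h h' _ j)

/-- Multiplication by the conjugate of the `j`-th coordinate of `z - w`. -/
def conjMulOp (Λ : Submodule ℤ (V g)) (hB : B.IsAlt) (j : Fin g) :
    Module.End (smoothFunctions Λ) (invariantFunctions Λ B) :=
  conjGauss hB (fun ψ p => conjCoordDiff j p * ψ p)
    (fun φ => by
      have e : (fun p => gauss B p * (conjCoordDiff j p * reduced B φ.1 p))
          = (fun p => conjCoordDiff j p) * φ.1 := funext fun p => by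
        rw [mul_left_comm, gauss_mul_reduced, Pi.mul_apply]
      rw [e]
      exact .mul (.of_clm _) φ.2.1)
    (fun _ _ _ => by simp [conjCoordDiff_apply]) (fun _ _ _ _ => by simp only [mul_add])
    (fun _ _ _ _ => funext fun p => mul_left_comm _ _ _)

/-- The conjugate by the Gaussian of the average along the `j`-th coordinate of `z - w`. -/
def averageOp (Λ : Submodule ℤ (V g)) (hB : B.IsAlt) (j : Fin g) (k : ℕ) :
    Module.End (smoothFunctions Λ) (invariantFunctions Λ B) :=
  conjGauss hB (average j k) (fun φ => φ.2.1.average B j k)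
    (fun _ _ _ => by simp only [average, scale_translate])
    (fun _ _ h h' => funext fun p => average_add h.continuous h'.continuous j k p)
    (fun f ψ _ _ => average_mul_of_scale_ne (L := fun p => f p.2)
      (fun s p => by simp only [scale_snd]) ψ k)

/-- The linear function `-2π (z_j - w_j)`. -/
def plusCoord (j : Fin g) : V g × V g →L[ℝ] ℂ := (-(2 * Real.pi)) • coordDiff j

lemma plusCoord_apply (j : Fin g) (p : V g × V g) :
    plusCoord j p = -(2 * Real.pi) * (p.1 j - p.2 j) := by
  simp [plusCoord, coordDiff_apply]

/-- The `dz̄_j`-component of the differential in the basis `dz̄, e⁺`. -/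
def barOp (Λ : Submodule ℤ (V g)) (B : LinearMap.BilinForm ℝ (V g)) (j : Fin g) :
    Module.End (smoothFunctions Λ) (invariantFunctions Λ B) :=
  nablaBar Λ B j + mulPhi Λ B j + Complex.I • mulDiff Λ B j

/-- The `e⁺_j`-component of the differential in the basis `dz̄, e⁺`. -/
def plusOp (Λ : Submodule ℤ (V g)) (B : LinearMap.BilinForm ℝ (V g)) (j : Fin g) :
    Module.End (smoothFunctions Λ) (invariantFunctions Λ B) :=
  -Complex.I • mulDiff Λ B j

/-! ### The operators after division by the Gaussian. -/

variable (φ : invariantFunctions Λ B)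

lemma reduced_delOp (hB : B.IsAlt) (j : Fin g) :
    reduced B (delOp Λ hB j φ).1 = wirtinger (-Complex.I) j (reduced B φ.1) :=
  reduced_gauss_mul _ _

lemma reduced_conjMulOp (hB : B.IsAlt) (j : Fin g) :
    reduced B (conjMulOp Λ hB j φ).1 = fun p => conjCoordDiff j p * reduced B φ.1 p :=
  reduced_gauss_mul _ _

lemma reduced_averageOp (hB : B.IsAlt) (j : Fin g) (k : ℕ) :
    reduced B (averageOp Λ hB j k φ).1 = average j k (reduced B φ.1) :=
  reduced_gauss_mul _ _

lemma reduced_plusOp (j : Fin g) : reduced B (plusOp Λ B j φ).1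
    = fun p => plusCoord j p * reduced B φ.1 p := by
  funext p
  have e : (plusOp Λ B j φ).1 p
      = -Complex.I * (2 * Real.pi * Complex.I * ((p.2 j - p.1 j) * φ.1 p)) := rfl
  rw [reduced, e, reduced, plusCoord_apply]
  linear_combination (2 * Real.pi * (p.1 j - p.2 j) * φ.1 p * Complex.exp (-gaussForm B p p))
    * Complex.I_sq

/-- The logarithmic `∂̄_j`-derivative of the Gaussian is `-2πi conj(B_j(w)) - 2π (z_j - w_j)`. The
potential terms of the operator cancel it exactly; this fixes both the exponent of the Gaussian and
the coefficient `i` in `e⁺_j`. -/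
lemma reduced_barOp (hB : B.IsAlt) (j : Fin g) :
    reduced B (barOp Λ B j φ).1 = wirtinger Complex.I j (reduced B φ.1) := by
  refine reduced_eq_of_eq B fun p => ?_
  have e : (barOp Λ B j φ).1 p = dbar j φ.1 p
      + 2 * Real.pi * Complex.I * (starRingEnd ℂ (coeffB B j p.1) * φ.1 p)
      + 2 * Real.pi * Complex.I * (starRingEnd ℂ (coeffB B j (p.2 - p.1)) * φ.1 p)
      + Complex.I * (2 * Real.pi * Complex.I * ((p.2 j - p.1 j) * φ.1 p)) := rfl
  have hs := φ.2.1.smooth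
  have h₁ := gauss_mul_fderiv_reduced B hs p (Pi.single j 1, 0)
  have h₂ := gauss_mul_fderiv_reduced B hs p (Pi.single j Complex.I, 0)
  have hsum : ∀ (c : ℂ) (u : V g), ∑ i, (Pi.single j c : V g) i * starRingEnd ℂ (u i)
      = c * starRingEnd ℂ (u j) := fun c u => by
    rw [Finset.sum_eq_single j (fun i _ hi => by simp [hi]) (by simp)]
    simp
  have hsum' : ∀ (c : ℂ) (u : V g), ∑ i, u i * starRingEnd ℂ ((Pi.single j c : V g) i)
      = u j * starRingEnd ℂ c := fun c u => by
    rw [Finset.sum_eq_single j (fun i _ hi => by simp [hi]) (by simp)]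
    simp
  have hl : ∀ c : ℂ, gaussLogDeriv B (Pi.single j c, 0) p
      = -(2 * Real.pi * Complex.I * (B p.2 (Pi.single j c) : ℂ))
        - 2 * Real.pi * (c * starRingEnd ℂ (p.1 j - p.2 j)
          + (p.1 j - p.2 j) * starRingEnd ℂ c) := by
    intro c
    have hh := hsum c (fun i => p.1 i - p.2 i)
    have hh' := hsum' c (fun i => p.1 i - p.2 i)
    rw [gaussLogDeriv_apply, gaussForm_apply, gaussForm_apply]
    simp only [Pi.zero_apply, sub_zero, map_zero]
    rw [hh, hh', ← LinearMap.IsAlt.neg hB p.2]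
    push_cast
    ring
  -- The role of `Φ`: it moves the connection term from `z` to `w`. The resulting operators commute
  -- with one another.
  have hc : starRingEnd ℂ (coeffB B j p.1) + starRingEnd ℂ (coeffB B j (p.2 - p.1))
      = starRingEnd ℂ (coeffB B j p.2) := by
    have := (conjCoeffB B j).map_add p.1 (p.2 - p.1)
    rw [add_sub_cancel] at this
    exact this.symm
  have hc' : starRingEnd ℂ (coeffB B j p.2)
      = ((B p.2 (Pi.single j 1) : ℂ) + Complex.I * (B p.2 (Pi.single j Complex.I) : ℂ)) / 2 := by
    have h2 : (starRingEnd ℂ) 2 = 2 := Complex.conj_ofNat 2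
    simp [coeffB, h2]
  rw [hl] at h₁ h₂
  rw [e, wirtinger, dbar]
  simp only [map_one, Complex.conj_I] at h₁ h₂
  linear_combination (-1 / 2) * h₁ - Complex.I / 2 * h₂
    + 2 * Real.pi * Complex.I * φ.1 p * (hc + hc')
    + (Real.pi * φ.1 p * ((p.2 j - p.1 j) - starRingEnd ℂ (p.1 j - p.2 j))) * Complex.I_sq

/-- Division by the nowhere vanishing Gaussian is injective, so operator identities may be checked
where they concern plain derivatives, coordinates and averages. -/
lemma commute_of_reduced {P Q : Module.End (smoothFunctions Λ) (invariantFunctions Λ B)}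
    (h : ∀ φ, reduced B (P (Q φ)).1 = reduced B (Q (P φ)).1) : Commute P Q :=
  LinearMap.ext fun φ => eq_of_reduced_eq (h φ)

end

section

variable {g : ℕ} {Λ : Submodule ℤ (V g)} {B : LinearMap.BilinForm ℝ (V g)}

/-! Relations between the operators. -/

lemma wirtinger_plusCoord_mul {ψ : V g × V g → ℂ} (h : ContDiff ℝ ∞ ψ) (i j : Fin g) :
    wirtinger Complex.I i (fun p => plusCoord j p * ψ p)
      = fun p => plusCoord j p * wirtinger Complex.I i ψ p := by
  funext p
  rw [wirtinger_clm_mul h, plusCoord_apply, plusCoord_apply]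
  by_cases hij : j = i
  · subst hij
    simp
    left
    linear_combination -(2 * Real.pi) * Complex.I_sq
  · simp [hij]

lemma wirtinger_neg_plusCoord_mul {ψ : V g × V g → ℂ} (h : ContDiff ℝ ∞ ψ) (i j : Fin g)
    (p : V g × V g) :
    wirtinger (-Complex.I) i (fun p => plusCoord j p * ψ p) p
      = plusCoord j p * wirtinger (-Complex.I) i ψ p
        - (if i = j then (2 * Real.pi : ℂ) else 0) * ψ p := by
  rw [wirtinger_clm_mul h, plusCoord_apply, plusCoord_apply]
  by_cases hij : i = j
  · subst hij
    simp
    linear_combination (Real.pi * ψ p) * Complex.I_sq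
  · simp [hij, Ne.symm hij]

lemma wirtinger_conj_mul {ψ : V g × V g → ℂ} (h : ContDiff ℝ ∞ ψ) (i j : Fin g)
    (p : V g × V g) :
    wirtinger Complex.I i (fun p => conjCoordDiff j p * ψ p) p
      = (if i = j then 1 else 0) * ψ p + conjCoordDiff j p * wirtinger Complex.I i ψ p := by
  rw [wirtinger_clm_mul h, conjCoordDiff_apply, conjCoordDiff_apply]
  by_cases hij : i = j
  · subst hij
    simp
  · simp [hij, Ne.symm hij]

lemma barOp_comm (hB : B.IsAlt) (i j : Fin g) : Commute (barOp Λ B i) (barOp Λ B j) :=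
  commute_of_reduced fun φ => by
    simp only [reduced_barOp _ hB]
    exact wirtinger_comm (contDiff_reduced_coe φ) _ _ _ _

lemma barOp_plusOp_comm (hB : B.IsAlt) (i j : Fin g) : Commute (barOp Λ B i) (plusOp Λ B j) :=
  commute_of_reduced fun φ => by
    simp only [reduced_barOp _ hB, reduced_plusOp]
    exact wirtinger_plusCoord_mul (contDiff_reduced_coe φ) _ _

lemma plusOp_comm (i j : Fin g) : Commute (plusOp Λ B i) (plusOp Λ B j) :=
  commute_of_reduced fun φ => by
    simp only [reduced_plusOp]
    exact funext fun p => mul_left_comm _ _ _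

lemma barOp_delOp_comm (hB : B.IsAlt) (i j : Fin g) : Commute (barOp Λ B i) (delOp Λ hB j) :=
  commute_of_reduced fun φ => by
    simp only [reduced_barOp _ hB, reduced_delOp]
    exact wirtinger_comm (contDiff_reduced_coe φ) _ _ _ _

lemma barOp_conjMulOp_comm (hB : B.IsAlt) {i j : Fin g} (h : i ≠ j) :
    Commute (barOp Λ B i) (conjMulOp Λ hB j) :=
  commute_of_reduced fun φ => by
    simp only [reduced_barOp _ hB, reduced_conjMulOp]
    funext p
    rw [wirtinger_conj_mul (contDiff_reduced_coe φ), if_neg h, zero_mul, zero_add]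

lemma barOp_averageOp_comm (hB : B.IsAlt) {i j : Fin g} (h : i ≠ j) (k : ℕ) :
    Commute (barOp Λ B i) (averageOp Λ hB j k) :=
  commute_of_reduced fun φ => by
    simp only [reduced_barOp _ hB, reduced_averageOp]
    exact wirtinger_average_of_ne (contDiff_reduced_coe φ) _ h k

lemma plusOp_delOp_comm (hB : B.IsAlt) {i j : Fin g} (h : i ≠ j) :
    Commute (plusOp Λ B i) (delOp Λ hB j) :=
  commute_of_reduced fun φ => by
    simp only [reduced_plusOp, reduced_delOp]
    funext p
    rw [wirtinger_neg_plusCoord_mul (contDiff_reduced_coe φ), if_neg h.symm, zero_mul, sub_zero]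

lemma plusOp_conjMulOp_comm (hB : B.IsAlt) (i j : Fin g) :
    Commute (plusOp Λ B i) (conjMulOp Λ hB j) :=
  commute_of_reduced fun φ => by
    simp only [reduced_plusOp, reduced_conjMulOp]
    exact funext fun p => mul_left_comm _ _ _

lemma plusCoord_scale (i j : Fin g) (s : ℝ) (p : V g × V g) :
    plusCoord i (scale j s p) = (if i = j then (s : ℂ) else 1) * plusCoord i p := by
  rw [plusCoord_apply, plusCoord_apply, scale_diff]
  ring

lemma plusOp_averageOp_comm (hB : B.IsAlt) {i j : Fin g} (h : i ≠ j) (k : ℕ) :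
    Commute (plusOp Λ B i) (averageOp Λ hB j k) :=
  commute_of_reduced fun φ => by
    simp only [reduced_plusOp, reduced_averageOp]
    exact (average_mul_of_scale_ne (fun s p => by rw [plusCoord_scale, if_neg h, one_mul]) _ k).symm

lemma barOp_mul_conjMulOp (hB : B.IsAlt) (j : Fin g) :
    barOp Λ B j * conjMulOp Λ hB j = 1 + conjMulOp Λ hB j * barOp Λ B j :=
  LinearMap.ext fun φ => eq_of_reduced_eq (by
    simp only [LinearMap.add_apply, Module.End.mul_apply, Module.End.one_apply]
    rw [reduced_add]
    simp only [reduced_barOp _ hB, reduced_conjMulOp]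
    funext p
    rw [wirtinger_conj_mul (contDiff_reduced_coe φ), if_pos rfl, one_mul])

lemma delOp_mul_plusOp (hB : B.IsAlt) (j : Fin g) :
    delOp Λ hB j * plusOp Λ B j = plusOp Λ B j * delOp Λ hB j - (2 * Real.pi : ℂ) • 1 :=
  LinearMap.ext fun φ => eq_of_reduced_eq (by
    simp only [LinearMap.sub_apply, LinearMap.smul_apply, Module.End.mul_apply,
      Module.End.one_apply]
    rw [reduced_sub, reduced_const_smul]
    simp only [reduced_delOp, reduced_plusOp]
    funext p
    rw [wirtinger_neg_plusCoord_mul (contDiff_reduced_coe φ), if_pos rfl])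

lemma averageOp_mul_plusOp (hB : B.IsAlt) (j : Fin g) (k : ℕ) :
    averageOp Λ hB j k * plusOp Λ B j = plusOp Λ B j * averageOp Λ hB j (k + 1) :=
  LinearMap.ext fun φ => eq_of_reduced_eq (by
    simp only [Module.End.mul_apply, reduced_averageOp, reduced_plusOp]
    exact average_mul_of_scale_self (fun s p => by rw [plusCoord_scale, if_pos rfl]) _ k)

lemma barOp_mul_averageOp (hB : B.IsAlt) (j : Fin g) (k : ℕ) :
    barOp Λ B j * averageOp Λ hB j k = averageOp Λ hB j (k + 1) * barOp Λ B j :=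
  LinearMap.ext fun φ => eq_of_reduced_eq (by
    simp only [Module.End.mul_apply, reduced_averageOp, reduced_barOp _ hB]
    exact wirtinger_average_self (contDiff_reduced_coe φ) _ j k)

lemma plusCoord_inv (j : Fin g) (p : V g × V g) :
    -(1 / (2 * Real.pi) : ℂ) * plusCoord j p = coordDiff j p := by
  have : (Real.pi : ℂ) ≠ 0 := by exact_mod_cast Real.pi_ne_zero
  rw [plusCoord_apply, coordDiff_apply]
  field_simp

/-- The fundamental theorem of calculus, for the conjugated operators. -/
lemma averageOp_ftc (hB : B.IsAlt) (j : Fin g) (k : ℕ) :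
    (k + 1 : ℂ) • averageOp Λ hB j k + conjMulOp Λ hB j * averageOp Λ hB j (k + 1) * barOp Λ B j
      + -(1 / (2 * Real.pi) : ℂ) • (plusOp Λ B j * averageOp Λ hB j (k + 1) * delOp Λ hB j) = 1 :=
  LinearMap.ext fun φ => eq_of_reduced_eq (by
    simp only [LinearMap.add_apply, LinearMap.smul_apply, Module.End.mul_apply,
      Module.End.one_apply]
    rw [reduced_add, reduced_add, reduced_const_smul, reduced_const_smul]
    simp only [reduced_averageOp, reduced_conjMulOp, reduced_plusOp, reduced_delOp,
      reduced_barOp _ hB]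
    funext p
    have h := average_fderiv_par (contDiff_reduced_coe φ) j k p
    rw [integral_fderiv_par_eq (contDiff_reduced_coe φ)] at h
    rw [← mul_assoc (-_), plusCoord_inv, ← h]
    ring)

/-- The operator `φ ↦ -(1 / 2π) ∫₀¹ s^k ∂φ/∂z_j ds`, conjugated by the Gaussian. -/
def averageDelOp (Λ : Submodule ℤ (V g)) (hB : B.IsAlt) (j : Fin g) (k : ℕ) :
    Module.End (smoothFunctions Λ) (invariantFunctions Λ B) :=
  -(1 / (2 * Real.pi) : ℂ) • (averageOp Λ hB j k * delOp Λ hB j)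

/-- Restriction to the hyperplane `z_j = w_j`, conjugated by the Gaussian. -/
def restrictOp (Λ : Submodule ℤ (V g)) (hB : B.IsAlt) (j : Fin g) :
    Module.End (smoothFunctions Λ) (invariantFunctions Λ B) :=
  1 - (plusOp Λ B j * averageDelOp Λ hB j 0
    + conjMulOp Λ hB j * averageOp Λ hB j 0 * barOp Λ B j)

/-- Defining the restriction as the defect of the homotopy makes its linearity and the Schwartz
estimates automatic; the fundamental theorem of calculus without weight then identifies it. -/
lemma reduced_restrictOp (hB : B.IsAlt) (j : Fin g) (φ : invariantFunctions Λ B) :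
    reduced B (restrictOp Λ hB j φ).1 = fun p => reduced B φ.1 (scale j 0 p) := by
  simp only [restrictOp, averageDelOp, LinearMap.sub_apply, LinearMap.add_apply,
    LinearMap.smul_apply, mul_smul_comm, Module.End.mul_apply, Module.End.one_apply]
  rw [reduced_sub, reduced_add, reduced_const_smul]
  simp only [reduced_averageOp, reduced_conjMulOp, reduced_plusOp, reduced_delOp,
    reduced_barOp _ hB]
  funext p
  have h := integral_fderiv_par (contDiff_reduced_coe φ) j p
  rw [integral_fderiv_par_eq (contDiff_reduced_coe φ)] at h
  rw [← mul_assoc (-_), plusCoord_inv, h]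
  ring

/-- Forms of all degrees. -/
abbrev TotalForms (Λ : Submodule ℤ (V g)) (B : LinearMap.BilinForm ℝ (V g)) : Type :=
  invariantFunctions Λ B ⊗[ℂ] ExteriorAlgebra ℂ (Covectors g)

instance : AddCommGroup (TotalForms Λ B) := inferInstance

/-- Endomorphisms of the module of forms of all degrees. -/
abbrev TotalEnd (Λ : Submodule ℤ (V g)) (B : LinearMap.BilinForm ℝ (V g)) : Type :=
  Module.End (smoothFunctions Λ) (TotalForms Λ B)

instance : Ring (TotalEnd Λ B) := inferInstance

/-- The homotopy that contracts the `j`-th factor of the Koszul complex. -/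
def homotopy (Λ : Submodule ℤ (V g)) (hB : B.IsAlt) (j : Fin g) :
    TotalEnd Λ B :=
  koszulHomotopy (conjMulOp Λ hB j * averageOp Λ hB j 0) (conjMulOp Λ hB j * averageOp Λ hB j 1)
    (averageDelOp Λ hB j 0) (averageDelOp Λ hB j 1) (eZ j) (eP j) (cZ j) (cP j)

/-- The `j`-th summand of the differential, on forms of all degrees. -/
def diffPart (Λ : Submodule ℤ (V g)) (B : LinearMap.BilinForm ℝ (V g)) (j : Fin g) :
    TotalEnd Λ B :=
  tensorOp (barOp Λ B j) (eZ j) + tensorOp (plusOp Λ B j) (eP j)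

/-- The differential on forms of all degrees. -/
def diffTotal (Λ : Submodule ℤ (V g)) (B : LinearMap.BilinForm ℝ (V g)) :
    TotalEnd Λ B :=
  ∑ j, diffPart Λ B j

/-- The projection to the cohomology of the `j`-th factor of the Koszul complex. -/
def projPart (Λ : Submodule ℤ (V g)) (hB : B.IsAlt) (j : Fin g) :
    TotalEnd Λ B :=
  tensorOp (restrictOp Λ hB j) (plusProj j)

/-- The one-variable computation: the commutators `[∂/∂z̄_j, conj(u_j)] = 1` and `[∂/∂z_j, v_j] =
-2π`, with the fundamental theorem for the weights `k = 0` and `k = 1`, supply all entries of the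
Koszul homotopy. -/
lemma diffPart_homotopy_self (hB : B.IsAlt) (j : Fin g) :
    diffPart Λ B j * homotopy Λ hB j + homotopy Λ hB j * diffPart Λ B j
      = (1 : TotalEnd Λ B) - projPart Λ hB j := by
  have hpi : -(1 / (2 * Real.pi) : ℂ) * -(2 * Real.pi) = 1 := by
    have : (Real.pi : ℂ) ≠ 0 := by exact_mod_cast Real.pi_ne_zero
    field_simp
  have h₀ := averageOp_ftc (Λ := Λ) hB j 0
  have h₁ := averageOp_ftc (Λ := Λ) hB j 1
  rw [Nat.cast_zero, zero_add, one_smul] at h₀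
  rw [Nat.cast_one, one_add_one_eq_two] at h₁
  obtain ⟨r₁, r₂, r₃, r₄, r₅, r₆⟩ := koszul_relations (A := averageOp Λ hB j) hpi
    (plusOp_conjMulOp_comm hB j j).eq (barOp_delOp_comm hB j j).eq (barOp_mul_conjMulOp hB j)
    (delOp_mul_plusOp hB j) (averageOp_mul_plusOp hB j) (barOp_mul_averageOp hB j) h₀ h₁
    (rfl : restrictOp Λ hB j = _)
  exact koszulHomotopy_spec (wedgeOp_sq _) (wedgeOp_sq _) (wedgeOp_mul_wedgeOp _ _)
    (contrOp_mul_contrOp _ _) ((cZ_eZ j j).trans (by rw [if_pos rfl]))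
    ((cP_eP j j).trans (by rw [if_pos rfl])) (cZ_eP j j) (cP_eZ j j) r₁ r₂ r₃ r₄ r₅ r₆

/-- The operators for different coordinates commute, and the wedges for one index anticommute with
the wedges and contractions for another. -/
lemma diffPart_homotopy_of_ne (hB : B.IsAlt) {i j : Fin g} (h : i ≠ j) :
    diffPart Λ B i * homotopy Λ hB j + homotopy Λ hB j * diffPart Λ B i = 0 := by
  have swap {x y : Module.End ℂ (ExteriorAlgebra ℂ (Covectors g))} (h : y * x = -(x * y)) :
      x * y = -(y * x) := by rw [h, neg_neg]
  refine koszulHomotopy_anticomm ?_ ?_ ?_ ?_ <;>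
    simp only [List.forall_mem_cons, List.not_mem_nil, false_imp_iff, implies_true, and_true]
  · have h₁ := fun k => barOp_averageOp_comm (Λ := Λ) hB h k
    have h₂ := fun k => ((h₁ k).mul_right (barOp_delOp_comm hB i j)).smul_right
      (-(1 / (2 * Real.pi) : ℂ))
    have h₃ := fun k => (barOp_conjMulOp_comm hB h).mul_right (h₁ k)
    exact ⟨h₃ 0, h₃ 1, h₂ 0, h₂ 1⟩
  · have h₁ := fun k => plusOp_averageOp_comm (Λ := Λ) hB h k
    have h₂ := fun k => ((h₁ k).mul_right (plusOp_delOp_comm hB h)).smul_right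
      (-(1 / (2 * Real.pi) : ℂ))
    have h₃ := fun k => (plusOp_conjMulOp_comm hB i j).mul_right (h₁ k)
    exact ⟨h₃ 0, h₃ 1, h₂ 0, h₂ 1⟩
  · refine ⟨wedgeOp_mul_wedgeOp _ _, wedgeOp_mul_wedgeOp _ _, swap ?_, swap (cP_eZ j i)⟩
    exact (cZ_eZ j i).trans (by rw [if_neg h.symm, zero_sub])
  · refine ⟨wedgeOp_mul_wedgeOp _ _, wedgeOp_mul_wedgeOp _ _, swap (cZ_eP j i), swap ?_⟩
    exact (cP_eP j i).trans (by rw [if_neg h.symm, zero_sub])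

lemma diffTotal_homotopy (hB : B.IsAlt) (j : Fin g) :
    diffTotal Λ B * homotopy Λ hB j + homotopy Λ hB j * diffTotal Λ B
      = (1 : TotalEnd Λ B) - projPart Λ hB j := by
  rw [diffTotal, Finset.sum_mul, Finset.mul_sum, ← Finset.sum_add_distrib,
    Finset.sum_eq_single j (fun i _ hi => diffPart_homotopy_of_ne hB hi) (by simp),
    diffPart_homotopy_self]

lemma diffPart_anticomm (hB : B.IsAlt) (i j : Fin g) :
    diffPart Λ B i * diffPart Λ B j + diffPart Λ B j * diffPart Λ B i = 0 :=
  tensorOp_add_anticomm (barOp_comm hB i j) (barOp_plusOp_comm hB i j)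
    (barOp_plusOp_comm hB j i).symm (plusOp_comm i j) (wedgeOp_mul_wedgeOp _ _)
    (wedgeOp_mul_wedgeOp _ _) (wedgeOp_mul_wedgeOp _ _) (wedgeOp_mul_wedgeOp _ _)

lemma diffTotal_sq (hB : B.IsAlt) : diffTotal Λ B * diffTotal Λ B = 0 :=
  sum_mul_self_eq_zero (R := TotalEnd Λ B) (diffPart_anticomm hB)

end

section

variable {g : ℕ} {Λ : Submodule ℤ (V g)} {B : LinearMap.BilinForm ℝ (V g)}

/-! Comparison of the differential on `Y Λ B n` with the one on forms of all degrees. -/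

/-- The inclusion of the forms of degree `n` into the forms of all degrees. -/
def incl (Λ : Submodule ℤ (V g)) (B : LinearMap.BilinForm ℝ (V g)) (n : ℕ) :
    Y Λ B n →ₗ[smoothFunctions Λ] TotalForms Λ B :=
  TensorProduct.AlgebraTensorModule.map LinearMap.id (⋀[ℂ]^n (Covectors g)).subtype

/-- The component of degree `n` of a form. -/
def degreePart (Λ : Submodule ℤ (V g)) (B : LinearMap.BilinForm ℝ (V g)) (n : ℕ) :
    TotalForms Λ B →ₗ[smoothFunctions Λ] Y Λ B n :=
  TensorProduct.AlgebraTensorModule.map LinearMap.id (projDegree n)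

lemma incl_tmul (n : ℕ) (φ : invariantFunctions Λ B) (x : ⋀[ℂ]^n (Covectors g)) :
    incl Λ B n (φ ⊗ₜ x) = φ ⊗ₜ x.1 := rfl

lemma degreePart_tmul (n : ℕ) (φ : invariantFunctions Λ B) (x : ExteriorAlgebra ℂ (Covectors g)) :
    degreePart Λ B n (φ ⊗ₜ x) = φ ⊗ₜ projDegree n x := rfl

lemma degreePart_incl (n : ℕ) (φ : Y Λ B n) : degreePart Λ B n (incl Λ B n φ) = φ := by
  induction φ using TensorProduct.induction_on with
  | zero => rw [map_zero, map_zero]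
  | tmul φ x => rw [incl_tmul, degreePart_tmul, projDegree_coe]
  | add φ ψ h h' => rw [map_add, map_add, h, h']

lemma degreePart_incl_of_ne {m n : ℕ} (h : m ≠ n) (φ : Y Λ B m) :
    degreePart Λ B n (incl Λ B m φ) = 0 := by
  induction φ using TensorProduct.induction_on with
  | zero => rw [map_zero, map_zero]
  | tmul φ x => rw [incl_tmul, degreePart_tmul, projDegree_of_ne h x.2, TensorProduct.tmul_zero]
  | add φ ψ h h' => rw [map_add, map_add, h, h', add_zero]

/-- This is the passage from `dz̄_j, dζ̄_j` to `dz̄_j, e⁺_j`, read off on the coefficients. -/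
lemma tmul_change_basis {W E : Type*} [AddCommGroup W] [Module ℂ W] [AddCommGroup E] [Module ℂ E]
    (a b : W) (x y : E) :
    (a + Complex.I • b) ⊗ₜ[ℂ] x + (-Complex.I • b) ⊗ₜ[ℂ] (x + Complex.I • y)
      = a ⊗ₜ x + b ⊗ₜ y := by
  simp only [TensorProduct.add_tmul, TensorProduct.tmul_add, TensorProduct.tmul_smul,
    TensorProduct.smul_tmul', smul_smul]
  rw [mul_neg, Complex.I_mul_I, neg_neg, one_smul, neg_smul, TensorProduct.neg_tmul]
  abel

lemma wedgeOp_ePlus (j : Fin g) (x : ExteriorAlgebra ℂ (Covectors g)) :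
    eP j x = eZ j x + Complex.I • wedgeOp (dzetaBar j) x := by
  simp only [wedgeOp_apply, ePlus, map_add, map_smul, add_mul, smul_mul_assoc]

lemma diffTotal_tmul (φ : invariantFunctions Λ B) (x : ExteriorAlgebra ℂ (Covectors g)) :
    diffTotal Λ B (φ ⊗ₜ x) = ∑ j, ((nablaBar Λ B j φ + mulPhi Λ B j φ) ⊗ₜ[ℂ] eZ j x
      + mulDiff Λ B j φ ⊗ₜ[ℂ] wedgeOp (dzetaBar j) x) := by
  rw [diffTotal, LinearMap.sum_apply]
  refine Finset.sum_congr rfl fun j _ => ?_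
  rw [← tmul_change_basis, ← wedgeOp_ePlus]
  rfl

lemma differential_tmul (n : ℕ) (φ : invariantFunctions Λ B) (x : ⋀[ℂ]^n (Covectors g)) :
    differential Λ B n (φ ⊗ₜ x)
      = ∑ j, ((nablaBar Λ B j φ + mulPhi Λ B j φ) ⊗ₜ[ℂ] wedge n (dzBar j) x
        + mulDiff Λ B j φ ⊗ₜ[ℂ] wedge n (dzetaBar j) x) := by
  rw [differential, Y₀, Phi, LinearMap.add_apply, LinearMap.sum_apply, LinearMap.sum_apply,
    ← Finset.sum_add_distrib]
  refine Finset.sum_congr rfl fun j _ => ?_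
  rw [TensorProduct.add_tmul, add_right_comm]
  rfl

lemma diffTotal_incl (n : ℕ) (φ : Y Λ B n) :
    diffTotal Λ B (incl Λ B n φ) = incl Λ B (n + 1) (differential Λ B n φ) := by
  induction φ using TensorProduct.induction_on with
  | zero => rw [map_zero, map_zero, map_zero, map_zero]
  | tmul φ x =>
    rw [incl_tmul, diffTotal_tmul, differential_tmul, map_sum]
    refine Finset.sum_congr rfl fun j _ => ?_
    rw [map_add]
    rfl
  | add φ ψ h h' => rw [map_add, map_add, map_add, map_add, h, h']

/-- The homotopies are built as endomorphisms of the forms of all degrees; compatibility of the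
projections with the differentials allows conclusions there to be cut down to a single degree. -/
lemma degreePart_diffTotal (n : ℕ) (t : TotalForms Λ B) :
    degreePart Λ B (n + 1) (diffTotal Λ B t) = differential Λ B n (degreePart Λ B n t) := by
  induction t using TensorProduct.induction_on with
  | zero => rw [map_zero, map_zero, map_zero, map_zero]
  | tmul φ x =>
    rw [degreePart_tmul, diffTotal_tmul, differential_tmul, map_sum]
    refine Finset.sum_congr rfl fun j _ => ?_
    have h : ∀ v : Covectors g, projDegree (n + 1) (wedgeOp v x) = wedge n v (projDegree n x) :=
      fun v => Subtype.ext (coe_projDegree_succ_wedgeOp n v x)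
    rw [map_add, degreePart_tmul, degreePart_tmul, h, h]
  | add φ ψ h h' => rw [map_add, map_add, map_add, map_add, h, h']

lemma degreePart_zero_diffTotal (t : TotalForms Λ B) :
    degreePart Λ B 0 (diffTotal Λ B t) = 0 := by
  induction t using TensorProduct.induction_on with
  | zero => rw [map_zero, map_zero]
  | tmul φ x =>
    rw [diffTotal_tmul, map_sum]
    refine Finset.sum_eq_zero fun j _ => ?_
    rw [map_add, degreePart_tmul, degreePart_tmul, projDegree_zero_wedgeOp,
      projDegree_zero_wedgeOp, TensorProduct.tmul_zero, TensorProduct.tmul_zero, add_zero]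
  | add φ ψ h h' => rw [map_add, map_add, h, h', add_zero]

lemma degreePart_diffTotal_mem_coboundaries (n : ℕ) (t : TotalForms Λ B) :
    degreePart Λ B n (diffTotal Λ B t) ∈ coboundaries Λ B n := by
  cases n with
  | zero => rw [degreePart_zero_diffTotal]; exact Submodule.zero_mem _
  | succ n => rw [degreePart_diffTotal]; exact ⟨_, rfl⟩

lemma exists_diffTotal_eq_of_mem_coboundaries {n : ℕ} {φ : Y Λ B n}
    (h : φ ∈ coboundaries Λ B n) : ∃ t, diffTotal Λ B t = incl Λ B n φ := by
  cases n with
  | zero => exact ⟨0, by rw [(Submodule.mem_bot _).1 h, map_zero, map_zero]⟩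
  | succ n =>
    obtain ⟨ψ, rfl⟩ := h
    exact ⟨incl Λ B n ψ, diffTotal_incl n ψ⟩

lemma differential_comp_differential (hB : B.IsAlt) (n : ℕ) :
    differential Λ B (n + 1) ∘ₗ differential Λ B n = 0 := by
  refine LinearMap.ext fun φ => ?_
  rw [LinearMap.comp_apply, ← degreePart_incl n φ, ← degreePart_diffTotal, ← degreePart_diffTotal,
    ← Module.End.mul_apply, diffTotal_sq hB, LinearMap.zero_apply, map_zero, LinearMap.zero_apply]

/-! The generator of the cohomology. -/

/-- The Gaussian, as an invariant function. -/
def gaussFunction (Λ : Submodule ℤ (V g)) (hB : B.IsAlt) : invariantFunctions Λ B :=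
  ⟨gauss B, isSchwartzInDifference_gauss B, by
    simpa using isInvariant_gauss_mul (Λ := Λ) hB (ψ := fun _ => 1) fun _ _ _ => rfl⟩

/-- The generator of the cohomology, among the forms of all degrees. -/
def generator (Λ : Submodule ℤ (V g)) (hB : B.IsAlt) : TotalForms Λ B :=
  gaussFunction Λ hB ⊗ₜ[ℂ] (topPlusForm g).1

lemma reduced_gauss : reduced B (gauss B) = fun _ => 1 :=
  reduced_eq_of_eq B fun _ => (mul_one _).symm

lemma gauss_diag (hB : B.IsAlt) (w : V g) : gauss B (w, w) = 1 := by
  rw [gauss_eq]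
  simp [sigma, hB w]

lemma barOp_gaussFunction (hB : B.IsAlt) (j : Fin g) : barOp Λ B j (gaussFunction Λ hB) = 0 :=
  eq_of_reduced_eq (by
    rw [reduced_barOp _ hB]
    funext p
    change wirtinger _ j (reduced B (gauss B)) p = reduced B (fun _ => 0) p
    rw [reduced_gauss]
    simp [wirtinger, reduced])

lemma diffTotal_generator (hB : B.IsAlt) : diffTotal Λ B (generator Λ hB) = 0 := by
  rw [diffTotal, LinearMap.sum_apply]
  refine Finset.sum_eq_zero fun j _ => ?_
  have e : diffPart Λ B j (generator Λ hB)
      = barOp Λ B j (gaussFunction Λ hB) ⊗ₜ eZ j (topPlusForm g).1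
        + plusOp Λ B j (gaussFunction Λ hB) ⊗ₜ eP j (topPlusForm g).1 := rfl
  rw [e, barOp_gaussFunction, eP_topPlusForm, TensorProduct.zero_tmul, TensorProduct.tmul_zero,
    add_zero]

lemma sigma_zero_right (v : V g) : sigma B v 0 = 1 := by simp [sigma]

/-- The restriction of an invariant function to the diagonal. -/
def diagonal (φ : invariantFunctions Λ B) : smoothFunctions Λ :=
  ⟨fun w => φ.1 (w, w), φ.2.1.smooth.comp (contDiff_id.prodMk contDiff_id), fun l hl w => by
    have := φ.2.2 l hl w w
    rwa [sub_self, sigma_zero_right, mul_one] at this⟩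

lemma reduced_restrictOp_list (hB : B.IsAlt) (l : List (Fin g)) (φ : invariantFunctions Λ B)
    (z w : V g) : reduced B ((l.map (restrictOp Λ hB)).prod φ).1 (z, w)
      = reduced B φ.1 (fun i => if i ∈ l then w i else z i, w) := by
  induction l generalizing z with
  | nil => simp
  | cons j l ih =>
    rw [List.map_cons, List.prod_cons, Module.End.mul_apply, reduced_restrictOp]
    beta_reduce
    have e : scale j 0 (z, w) = (fun i => if i = j then w i else z i, w) := by
      refine Prod.ext (funext fun i => ?_) (scale_snd _ _ _)
      have h := scale_diff j i 0 (z, w)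
      rw [scale_snd] at h
      split_ifs at h with hi
      · simpa [hi, sub_eq_zero] using h
      · simpa [hi] using h
    rw [e, ih]
    congr 2
    funext i
    by_cases h₁ : i = j <;> by_cases h₂ : i ∈ l <;> simp [h₁, h₂]

/-- After all restrictions `φ / a` is evaluated at `(w, w)`, where the Gaussian equals `1`, so the
remaining coefficient is the value of `φ` on the diagonal. -/
lemma restrictOp_list_apply (hB : B.IsAlt) (φ : invariantFunctions Λ B) :
    ((List.finRange g).map (restrictOp Λ hB)).prod φ = diagonal φ • gaussFunction Λ hB := by
  refine Subtype.ext (funext fun p => ?_)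
  obtain ⟨z, w⟩ := p
  rw [smul_apply, ← gauss_mul_reduced (B := B) (Subtype.val _), reduced_restrictOp_list]
  simp only [List.mem_finRange, if_true]
  have h := gauss_mul_reduced (B := B) φ.1 (w, w)
  rw [gauss_diag hB, one_mul] at h
  rw [mul_comm]
  exact congrArg₂ _ h rfl

lemma projPart_list_prod (hB : B.IsAlt) :
    ((List.finRange g).map (projPart Λ hB)).prod
      = tensorOp ((List.finRange g).map (restrictOp Λ hB)).prod
        ((List.finRange g).map plusProj).prod :=
  tensorOp_list_prod _ _ _

/-- The product of the projections maps every form to a multiple of the generator. -/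
lemma exists_projPart_list_eq_smul (hB : B.IsAlt) (t : TotalForms Λ B) :
    ∃ f : smoothFunctions Λ,
      ((List.finRange g).map (projPart Λ hB)).prod t = f • generator Λ hB := by
  rw [projPart_list_prod]
  induction t using TensorProduct.induction_on with
  | zero => exact ⟨0, by rw [map_zero, zero_smul]⟩
  | tmul φ x =>
    obtain ⟨c, hc⟩ := exists_plusProj_eq_smul_top x
    refine ⟨c • diagonal φ, ?_⟩
    rw [tensorOp, TensorProduct.AlgebraTensorModule.map_tmul, hc, restrictOp_list_apply,
      TensorProduct.tmul_smul, smul_assoc]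
    rfl
  | add t t' h h' =>
    obtain ⟨f, hf⟩ := h
    obtain ⟨f', hf'⟩ := h'
    exact ⟨f + f', by rw [map_add, hf, hf', add_smul]⟩

lemma diagonal_gaussFunction (hB : B.IsAlt) : diagonal (gaussFunction Λ hB) = 1 :=
  Subtype.ext (funext fun w => gauss_diag hB w)

lemma projPart_list_generator (hB : B.IsAlt) :
    ((List.finRange g).map (projPart Λ hB)).prod (generator Λ hB) = generator Λ hB := by
  rw [projPart_list_prod, generator, tensorOp, TensorProduct.AlgebraTensorModule.map_tmul,
    restrictOp_list_apply, plusProj_list_topPlusForm, diagonal_gaussFunction, one_smul]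

/-! ### Determination of the cohomology by the generator. -/

lemma tmul_left_eq_zero {W E : Type*} [AddCommGroup W] [Module ℂ W] [AddCommGroup E] [Module ℂ E]
    {a : W} {x : E} (hx : x ≠ 0) (h : a ⊗ₜ[ℂ] x = 0) : a = 0 := by
  obtain ⟨f, hf⟩ := Module.Projective.exists_dual_ne_zero ℂ hx
  have := congrArg (TensorProduct.rid ℂ W ∘ TensorProduct.map LinearMap.id f) h
  simp only [Function.comp_apply, TensorProduct.map_tmul, map_zero, TensorProduct.rid_tmul,
    LinearMap.id_apply] at this
  exact (smul_eq_zero.1 this).resolve_left hf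

lemma smul_generator_eq_zero (hB : B.IsAlt) {f : smoothFunctions Λ}
    (h : f • generator Λ hB = 0) : f = 0 := by
  have h' : f • gaussFunction Λ hB = 0 := tmul_left_eq_zero topPlusForm_coe_ne_zero h
  refine Subtype.ext (funext fun w => ?_)
  have := congrFun (congrArg Subtype.val h') (w, w)
  rw [smul_apply] at this
  refine (mul_eq_zero.1 this).resolve_right (gauss_ne_zero B _)

/-- Every form is, up to exact forms and the homotopy, a multiple of the generator. -/
lemma exists_eq_diffTotal_add_smul (hB : B.IsAlt) {t : TotalForms Λ B}
    (ht : diffTotal Λ B t = 0) :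
    ∃ (s : TotalForms Λ B) (f : smoothFunctions Λ), t = diffTotal Λ B s + f • generator Λ hB := by
  obtain ⟨k, hk⟩ := exists_homotopy_list_prod (R := TotalEnd Λ B) (diffTotal_sq hB)
    (diffTotal_homotopy hB) (List.finRange g)
  obtain ⟨f, hf⟩ := exists_projPart_list_eq_smul hB t
  refine ⟨k t, f, ?_⟩
  have h := LinearMap.congr_fun (eq_add_of_sub_eq hk.symm) t
  refine h.trans ?_
  rw [← hf]
  change diffTotal Λ B (k t) + k (diffTotal Λ B t) + _ = _
  rw [ht, map_zero, add_zero]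

/-- The product `Π` of the projections fixes the generator, commutes with the differential, and
sends any form to a multiple of the closed generator. Hence `f` times the generator equals `Π d t =
d Π t = 0`, and the Gaussian has no zeros. -/
lemma smul_generator_eq_diffTotal (hB : B.IsAlt) {t : TotalForms Λ B} {f : smoothFunctions Λ}
    (h : diffTotal Λ B t = f • generator Λ hB) : f = 0 := by
  have hc := LinearMap.congr_fun (comm_list_prod_of_homotopy (R := TotalEnd Λ B) (diffTotal_sq hB)
    (diffTotal_homotopy hB) (List.finRange g)) t
  rw [Module.End.mul_apply, Module.End.mul_apply, h, map_smul, projPart_list_generator] at hc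
  obtain ⟨f', hf'⟩ := exists_projPart_list_eq_smul hB t
  rw [hf', map_smul, diffTotal_generator, smul_zero] at hc
  exact smul_generator_eq_zero hB hc.symm

lemma incl_injective (n : ℕ) : Function.Injective (incl Λ B n) :=
  Function.LeftInverse.injective (degreePart_incl n)

lemma incl_generator (hB : B.IsAlt) :
    incl Λ B g (gaussFunction Λ hB ⊗ₜ topPlusForm g) = generator Λ hB := rfl

lemma generator_mem_cocycles (hB : B.IsAlt) :
    gaussFunction Λ hB ⊗ₜ[ℂ] topPlusForm g ∈ cocycles Λ B g := by
  refine incl_injective _ ?_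
  rw [← diffTotal_incl, incl_generator, diffTotal_generator, map_zero]

lemma exists_sub_smul_mem_coboundaries (hB : B.IsAlt) {n : ℕ} {φ : Y Λ B n}
    (hφ : φ ∈ cocycles Λ B n) : ∃ f : smoothFunctions Λ,
      φ - f • degreePart Λ B n (generator Λ hB) ∈ coboundaries Λ B n := by
  obtain ⟨s, f, h⟩ := exists_eq_diffTotal_add_smul hB (t := incl Λ B n φ) (by
    rw [diffTotal_incl, LinearMap.mem_ker.1 hφ, map_zero])
  refine ⟨f, ?_⟩
  have h' := congrArg (degreePart Λ B n) h
  rw [degreePart_incl, map_add, map_smul] at h'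
  rw [sub_eq_of_eq_add h']
  exact degreePart_diffTotal_mem_coboundaries n s

/-- The cohomology vanishes outside degree `g`. -/
lemma subsingleton_cohomology (hB : B.IsAlt) {n : ℕ} (hn : n ≠ g) :
    Subsingleton (cohomology Λ B n) := by
  rw [Submodule.Quotient.subsingleton_iff, eq_top_iff]
  rintro ⟨φ, hφ⟩ -
  obtain ⟨f, h⟩ := exists_sub_smul_mem_coboundaries hB hφ
  -- The generator is homogeneous of degree `g`, so it has no component in degree `n` and the
  -- cocycle itself is a coboundary.
  rw [← incl_generator, degreePart_incl_of_ne hn.symm, smul_zero, sub_zero] at h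
  exact h

/-- The cohomology of degree `g` is free, generated by the class of the generator. -/
def cohomologyBasis (Λ : Submodule ℤ (V g)) (hB : B.IsAlt) :
    Module.Basis Unit (smoothFunctions Λ) (cohomology Λ B g) :=
  .mk (v := fun _ => Submodule.Quotient.mk ⟨_, generator_mem_cocycles hB⟩)
    (by
      rw [Fintype.linearIndependent_iff]
      intro f hf i
      rw [Fintype.sum_unique, ← Submodule.Quotient.mk_smul, Submodule.Quotient.mk_eq_zero] at hf
      obtain ⟨t, ht⟩ := exists_diffTotal_eq_of_mem_coboundaries hf
      rw [Submodule.subtype_apply, Submodule.coe_smul, map_smul] at ht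
      exact smul_generator_eq_diffTotal hB ht)
    (by
      rintro x -
      obtain ⟨⟨φ, hφ⟩, rfl⟩ := Submodule.Quotient.mk_surjective _ x
      obtain ⟨f, h⟩ := exists_sub_smul_mem_coboundaries hB hφ
      rw [← incl_generator, degreePart_incl] at h
      rw [Set.range_const, Submodule.mem_span_singleton]
      refine ⟨f, Eq.symm ?_⟩
      rw [← Submodule.Quotient.mk_smul, Submodule.Quotient.eq]
      exact h)

end

end MukaiTorus

end

theorem mainTheorem3 (g : ℕ) (Λ : Submodule ℤ (Fin g → ℂ)) [DiscreteTopology Λ]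
    [IsZLattice ℝ Λ] (B : LinearMap.BilinForm ℝ (Fin g → ℂ)) (hB : B.IsAlt) :
    -- `𝕐⁰ + Φ` is a differential
    (∀ n, MukaiTorus.differential Λ B (n + 1) ∘ₗ MukaiTorus.differential Λ B n = 0) ∧
    -- the cohomology vanishes outside degree `g`
    (∀ n, n ≠ g → Subsingleton (MukaiTorus.cohomology Λ B n)) ∧
    -- in degree `g` it is free of rank one, generated by the class of `a ⊗ e⁺₁ ∧ ⋯ ∧ e⁺_g`
    ∃ a : MukaiTorus.invariantFunctions Λ B,
      (∀ z w : Fin g → ℂ, a.1 (z, w) = MukaiTorus.sigma B z w *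
        Complex.exp (((-2 * Real.pi * ∑ j, ‖z j - w j‖ ^ 2 : ℝ) : ℂ))) ∧
      ∃ h : a ⊗ₜ[ℂ] MukaiTorus.topPlusForm g ∈ MukaiTorus.cocycles Λ B g,
      ∃ b : Module.Basis Unit (MukaiTorus.smoothFunctions Λ) (MukaiTorus.cohomology Λ B g),
        b () = Submodule.Quotient.mk ⟨a ⊗ₜ[ℂ] MukaiTorus.topPlusForm g, h⟩ :=
  ⟨MukaiTorus.differential_comp_differential hB,
    fun _ hn => MukaiTorus.subsingleton_cohomology hB hn,
    MukaiTorus.gaussFunction Λ hB, MukaiTorus.gauss_eq B, MukaiTorus.generator_mem_cocycles hB,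
    MukaiTorus.cohomologyBasis Λ hB, Module.Basis.mk_apply _ _ _⟩
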